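/- **Theorem (Weitzenböck identity).** Let $E,F,G$ be real or complex Hilbert spaces (all over the same field $\mathbb K$; e.g. finite-dimensional inner product spaces), let $\langle\cdot,\cdot\rangle$ denote the (real part of the) inner product, and let $A_j\in\mathcal L(F,G)$, $B_j\in\mathcal L(F,E)$ $(1\le j\le n)$ be arbitrary bounded $\mathbb K$-linear maps. Consider the operators $\mathscr A=\sum_{j=1}^n A_j\partial_j$ and $\mathscr B=\sum_{j=1}^n B_j\partial_j$, and the symbol $\mathbb B(\xi)=\sum_{j=1}^n \xi_jB_j$, $\xi\in\mathbb R^n$. Put $M_{ij}=A_i^*A_j+B_j^*B_i\in\mathcal L(F)$, and for a real linear map $X:\mathbb R^n\to F$ let $\mathbb M X:\mathbb R^n\to F$ be the real linear map with $(\mathbb MX)(e_i)=\sum_{j=1}^n M_{ij}X(e_j)$, $1\le i\le n$; for two such maps put $\langle X,Y\rangle=\sum_{j=1}^n\langle Xe_j,Ye_j\rangle$. Let $\Omega\subset\mathbb R^n$ be a bounded $C^2$ domain, that is, a bounded open set (not necessarily connected) which near each of its boundary points is, in suitable Cartesian coordinates, the region on one side of the graph of a $C^2$ function. Let $\nu$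 be the outward unit normal on $\partial\Omega$, let $\sigma$ be the surface measure on $\partial\Omega$, let $N$ be any $C^1$ vector field on a neighbourhood of $\partial\Omega$ with $N=\nu$ on $\partial\Omega$, and let $$L_B(x)=\sum_{j=1}^n\mathbb B(e_j)^*\,\mathbb B(\partial_jN(x)),\qquad x\in\partial\Omega,$$ be the generalized Levi matrix. Let $u\in C^1(\overline\Omega,F)$, that is, $u$ is $C^1$ in $\Omega$ and $u$ and its derivative $Du$ extend continuously to $\overline\Omega$. If $\mathbb B(\nu(x))u(x)=0$ for all $x\in\partial\Omega$, then the three integrals below converge absolutely and $$\int_\Omega\bigl(|\mathscr Au|^2+|\mathscr Bu|^2\bigr)\,dx-\int_\Omega\langle Du,\mathbb M Du\rangle\,dx=\int_{\partial\Omega}\langle u(x),L_B(x)u(x)\rangle\,d\sigma(x).$$ -/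

import Mathlib

open MeasureTheory Topology
open scoped InnerProductSpace

/-- `Ω ⊆ ℝⁿ` is a `C²` domain: `Ω` is open and near each boundary point it is, in suitable
Cartesian coordinates, the region strictly above the graph of a `C²` function (the coordinates
being the height `⟪e, y⟫` along a unit vector `e` and the orthogonal projection of `y` on the
hyperplane `eᗮ`). Connectedness is not required. -/
structure IsC2Domain {n : ℕ} (Ω : Set (EuclideanSpace ℝ (Fin n))) : Prop where
  isOpen : IsOpen Ω
  exists_graph : ∀ x ∈ frontier Ω, ∃ r > (0 : ℝ), ∃ e : EuclideanSpace ℝ (Fin n), ‖e‖ = 1 ∧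
    ∃ γ : (Submodule.span ℝ {e})ᗮ → ℝ, ContDiff ℝ 2 γ ∧
      ∀ y ∈ Metric.ball x r,
        (y ∈ Ω ↔ γ ((Submodule.span ℝ {e})ᗮ.orthogonalProjectionOnto y) < ⟪e, y⟫_ℝ)

/-- `v` is the outward unit normal of `Ω` at `x`: a unit vector such that, to first order at `x`,
the set `Ω` is the half space `{y | ⟪v, y - x⟫ < 0}`. Such a `v` is unique
(`IsOutwardUnitNormal.unique`), and it exists at each boundary point of a `C²` domain
(`IsC2Domain.isOutwardUnitNormal`). -/
def IsOutwardUnitNormal {n : ℕ} (Ω : Set (EuclideanSpace ℝ (Fin n)))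
    (x v : EuclideanSpace ℝ (Fin n)) : Prop :=
  ‖v‖ = 1 ∧ ∀ ε > (0 : ℝ), ∀ᶠ y in 𝓝 x,
    (ε * ‖y - x‖ < ⟪v, y - x⟫_ℝ → y ∉ Ω) ∧ (⟪v, y - x⟫_ℝ < -(ε * ‖y - x‖) → y ∈ Ω)

/-- The outward unit normal `ν(x)` of `Ω` at `x`. -/
noncomputable def outwardUnitNormal {n : ℕ} (Ω : Set (EuclideanSpace ℝ (Fin n)))
    (x : EuclideanSpace ℝ (Fin n)) : EuclideanSpace ℝ (Fin n) :=
  Classical.epsilon (IsOutwardUnitNormal Ω x)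

theorem IsOutwardUnitNormal.unique {n : ℕ} {Ω : Set (EuclideanSpace ℝ (Fin n))}
    {x v w : EuclideanSpace ℝ (Fin n)} (hv : IsOutwardUnitNormal Ω x v)
    (hw : IsOutwardUnitNormal Ω x w) : v = w := by
  by_contra hne
  have hc : ⟪v, w⟫_ℝ < 1 := by
    refine lt_of_le_of_ne ?_ ?_
    · simpa [hv.1, hw.1] using real_inner_le_norm v w
    · intro h
      exact hne ((inner_eq_one_iff_of_norm_eq_one hv.1 hw.1).1 h)
  have hd : 0 < ‖v - w‖ := norm_pos_iff.2 (sub_ne_zero.2 hne)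
  set c := ⟪v, w⟫_ℝ with hcdef
  set ε : ℝ := (1 - c) / (2 * ‖v - w‖) with hε
  have hεpos : 0 < ε := by have := sub_pos.2 hc; positivity
  have hεd : ε * ‖v - w‖ = (1 - c) / 2 := by rw [hε]; field_simp
  have hvd : ⟪v, v - w⟫_ℝ = 1 - c := by
    rw [inner_sub_right, real_inner_self_eq_norm_sq, hv.1]; norm_num [hcdef]
  have hwd : ⟪w, v - w⟫_ℝ = -(1 - c) := by
    rw [inner_sub_right, real_inner_self_eq_norm_sq, hw.1, real_inner_comm]; norm_num [hcdef]
  have htend : Filter.Tendsto (fun t : ℝ => x + t • (v - w)) (𝓝[>] 0) (𝓝 x) := by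
    have : ContinuousAt (fun t : ℝ => x + t • (v - w)) 0 := by fun_prop
    have h := this.tendsto
    simp only [zero_smul, add_zero] at h
    exact h.mono_left nhdsWithin_le_nhds
  have h1 := htend.eventually (hv.2 ε hεpos)
  have h2 := htend.eventually (hw.2 ε hεpos)
  obtain ⟨t, ⟨h1, h2⟩, ht⟩ := ((h1.and h2).and self_mem_nhdsWithin).exists
  have ht : 0 < t := ht
  have hn : ε * ‖x + t • (v - w) - x‖ = t * ((1 - c) / 2) := by
    rw [add_sub_cancel_left, norm_smul, Real.norm_of_nonneg ht.le, ← hεd]; ring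
  have hp : 0 < t * (1 - c) := mul_pos ht (sub_pos.2 hc)
  refine h1.1 ?_ (h2.2 ?_)
  · rw [hn, add_sub_cancel_left, inner_smul_right, hvd]; linarith
  · rw [hn, add_sub_cancel_left, inner_smul_right, hwd]; linarith

theorem IsC2Domain.isOutwardUnitNormal {n : ℕ} {Ω : Set (EuclideanSpace ℝ (Fin n))}
    (hΩ : IsC2Domain Ω) {x : EuclideanSpace ℝ (Fin n)} (hx : x ∈ frontier Ω) :
    IsOutwardUnitNormal Ω x (outwardUnitNormal Ω x) := by
  apply Classical.epsilon_spec (p := IsOutwardUnitNormal Ω x)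
  obtain ⟨r, hr, e, he, γ, hγ, hg⟩ := hΩ.exists_graph x hx
  set P := (Submodule.span ℝ {e})ᗮ.orthogonalProjectionOnto with hP
  set ρ : EuclideanSpace ℝ (Fin n) → ℝ := fun y => γ (P y) - ⟪e, y⟫_ℝ with hρ
  have hcd : ContDiff ℝ 2 ρ := (hγ.comp P.contDiff).sub (contDiff_const.inner ℝ contDiff_id)
  have hdiff : DifferentiableAt ℝ ρ x := (hcd.differentiable (by norm_num)) x
  have hmem : ∀ y ∈ Metric.ball x r, (y ∈ Ω ↔ ρ y < 0) := fun y hy => by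
    rw [hg y hy, hρ]; simp [sub_neg]
  have hρx : ρ x = 0 := by
    have hxb : Metric.ball x r ∈ 𝓝 x := Metric.ball_mem_nhds x hr
    apply le_antisymm
    · by_contra! h
      have h1 : ∀ᶠ y in 𝓝 x, 0 < ρ y := hcd.continuous.continuousAt.eventually_const_lt h
      have h2 : ∃ᶠ y in 𝓝 x, y ∈ Ω := mem_closure_iff_frequently.1 (frontier_subset_closure hx)
      obtain ⟨y, hy, hy1, hy2⟩ := (h2.and_eventually (h1.and hxb)).exists
      exact absurd ((hmem y hy2).1 hy) (not_lt.2 hy1.le)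
    · by_contra! h
      have hxΩ : x ∈ Ω := (hmem x (Metric.mem_ball_self hr)).2 h
      rw [hΩ.isOpen.frontier_eq] at hx
      exact hx.2 hxΩ
  set g := (InnerProductSpace.toDual ℝ (EuclideanSpace ℝ (Fin n))).symm (fderiv ℝ ρ x) with hgdef
  have hgi : ∀ w, ⟪g, w⟫_ℝ = fderiv ℝ ρ x w := fun w => by
    rw [hgdef, InnerProductSpace.toDual_symm_apply]
  have hge : ⟪g, e⟫_ℝ = -1 := by
    rw [hgi]
    have hline : HasDerivAt (fun t : ℝ => ρ (x + t • e)) (fderiv ℝ ρ x e) 0 := by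
      have h1 : HasFDerivAt ρ (fderiv ℝ ρ x) (x + (0 : ℝ) • e) := by simpa using hdiff.hasFDerivAt
      have h2 : HasDerivAt (fun t : ℝ => x + t • e) e 0 := by
        simpa using ((hasDerivAt_id (0 : ℝ)).smul_const e).const_add x
      exact h1.comp_hasDerivAt 0 h2
    have hPe : P e = 0 := by
      rw [hP, Submodule.orthogonalProjectionOnto_eq_zero_iff, Submodule.orthogonal_orthogonal]
      exact Submodule.mem_span_singleton_self e
    have heq : (fun t : ℝ => ρ (x + t • e)) = fun t => ρ x - t := by
      funext t
      simp only [hρ, map_add, map_smul, hPe, smul_zero, add_zero, inner_add_right,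
        inner_smul_right, real_inner_self_eq_norm_sq, he]
      ring
    rw [heq] at hline
    have h3 : HasDerivAt (fun t : ℝ => ρ x - t) (-1) 0 := by
      simpa using (hasDerivAt_id (0 : ℝ)).const_sub (ρ x)
    exact hline.unique h3
  have hg0 : g ≠ 0 := by rintro h; rw [h] at hge; simp at hge
  have hgn : 0 < ‖g‖ := norm_pos_iff.2 hg0
  refine ⟨‖g‖⁻¹ • g, by rw [norm_smul, norm_inv, norm_norm, inv_mul_cancel₀ hgn.ne'], ?_⟩
  intro ε hε
  have hlo := hdiff.hasFDerivAt.isLittleO.def (mul_pos hε hgn)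
  filter_upwards [hlo, Metric.ball_mem_nhds x hr] with y hy hyb
  rw [hρx, sub_zero, ← hgi, Real.norm_eq_abs, abs_le] at hy
  have hsc : ⟪‖g‖⁻¹ • g, y - x⟫_ℝ * ‖g‖ = ⟪g, y - x⟫_ℝ := by
    rw [real_inner_smul_left]; field_simp
  rw [hmem y hyb, ← mul_lt_mul_iff_left₀ hgn,
    ← mul_lt_mul_iff_left₀ (b := ⟪‖g‖⁻¹ • g, y - x⟫_ℝ) hgn, hsc]
  constructor
  · intro h; nlinarith [hy.1]
  · intro h; nlinarith [hy.2]

/-- `u ∈ C¹(Ω̄, F)`: `u` is continuously differentiable in `Ω`, and `u` and its derivative extend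
continuously to the closure of `Ω` (on the boundary, `u` denotes this extension). -/
def IsC1OnClosure {n : ℕ} {F : Type*} [NormedAddCommGroup F] [NormedSpace ℝ F]
    (Ω : Set (EuclideanSpace ℝ (Fin n))) (u : EuclideanSpace ℝ (Fin n) → F) : Prop :=
  ContinuousOn u (closure Ω) ∧
    ∃ u' : EuclideanSpace ℝ (Fin n) → (EuclideanSpace ℝ (Fin n) →L[ℝ] F),
      ContinuousOn u' (closure Ω) ∧ ∀ x ∈ Ω, HasFDerivAt u (u' x) x

section Operators

variable {𝕜 : Type*} [RCLike 𝕜] {n : ℕ}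
  {E F G : Type*}
  [NormedAddCommGroup E] [InnerProductSpace 𝕜 E]
  [NormedAddCommGroup F] [InnerProductSpace 𝕜 F]
  [NormedAddCommGroup G] [InnerProductSpace 𝕜 G]

/-- The symbol `𝔸(ξ) = ∑ⱼ ξⱼ Aⱼ`, `ξ ∈ ℝⁿ`, of the operator `∑ⱼ Aⱼ ∂ⱼ`. -/
noncomputable def opSymbol (A : Fin n → F →L[𝕜] G) (ξ : EuclideanSpace ℝ (Fin n)) : F →L[𝕜] G :=
  ∑ j, ((ξ j : ℝ) : 𝕜) • A j

/-- The first order homogeneous constant coefficient operator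
`(𝒜 u)(x) = ∑ⱼ Aⱼ (∂ⱼ u)(x)`. -/
noncomputable def diffOp [NormedSpace ℝ F] (A : Fin n → F →L[𝕜] G)
    (u : EuclideanSpace ℝ (Fin n) → F) (x : EuclideanSpace ℝ (Fin n)) : G :=
  ∑ j, A j (fderiv ℝ u x (EuclideanSpace.single j 1))

/-- `Mᵢⱼ = Aᵢ* Aⱼ + Bⱼ* Bᵢ`. -/
noncomputable def laplaceCoeff [CompleteSpace E] [CompleteSpace F] [CompleteSpace G]
    (A : Fin n → F →L[𝕜] G) (B : Fin n → F →L[𝕜] E) (i j : Fin n) : F →L[𝕜] F :=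
  (ContinuousLinearMap.adjoint (A i)).comp (A j) + (ContinuousLinearMap.adjoint (B j)).comp (B i)

/-- `𝕄(X) = ∑ᵢⱼ (Mᵢⱼ X(eⱼ)) ⊗ eᵢ` for a real linear `X : ℝⁿ → F`, where `f ⊗ eᵢ` is the map
`v ↦ vᵢ f`. -/
noncomputable def laplaceMap [CompleteSpace E] [CompleteSpace F] [CompleteSpace G]
    [NormedSpace ℝ F] (A : Fin n → F →L[𝕜] G) (B : Fin n → F →L[𝕜] E)
    (X : EuclideanSpace ℝ (Fin n) →L[ℝ] F) : EuclideanSpace ℝ (Fin n) →L[ℝ] F :=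
  ∑ i, ∑ j, ContinuousLinearMap.smulRight (EuclideanSpace.proj i : EuclideanSpace ℝ (Fin n) →L[ℝ] ℝ)
    (laplaceCoeff A B i j (X (EuclideanSpace.single j 1)))

variable (𝕜) in
/-- `⟨X, Y⟩ = Re tr(X* Y) = ∑ⱼ Re ⟨X eⱼ, Y eⱼ⟩` for real linear `X, Y : ℝⁿ → F`. -/
noncomputable def traceInner [NormedSpace ℝ F] (X Y : EuclideanSpace ℝ (Fin n) →L[ℝ] F) : ℝ :=
  ∑ j, RCLike.re (inner 𝕜 (X (EuclideanSpace.single j 1)) (Y (EuclideanSpace.single j 1)))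

/-- The generalized Levi matrix `L_B(x) = ∑ⱼ 𝔹(eⱼ)* 𝔹(∂ⱼN(x))` computed from the field `N`. -/
noncomputable def leviMatrix [CompleteSpace E] [CompleteSpace F] (B : Fin n → F →L[𝕜] E)
    (N : EuclideanSpace ℝ (Fin n) → EuclideanSpace ℝ (Fin n)) (x : EuclideanSpace ℝ (Fin n)) :
    F →L[𝕜] F :=
  ∑ j, (ContinuousLinearMap.adjoint (opSymbol B (EuclideanSpace.single j 1))).comp
    (opSymbol B (fderiv ℝ N x (EuclideanSpace.single j 1)))

end Operators

/-! Write `b i j (f, g) = Re ⟨B i f, B j g⟩`. Expanding both volume integrands, the terms in `A`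
cancel and there remains `∑ i j, (b i j (∂ᵢu, ∂ⱼu) - b i j (∂ⱼu, ∂ᵢu))`. This is a null Lagrangian:
for `u` of class `C²` each term equals `∂ᵢ(b i j (u, ∂ⱼu)) - ∂ⱼ(b i j (u, ∂ᵢu))`, because the mixed
second derivatives cancel. The divergence theorem turns its integral into that of `νᵢ b i j (u, ∂ⱼu)
- νⱼ b i j (u, ∂ᵢu)` over `∂Ω` (`IsC2Domain.integral_antisymm`).

On the boundary the first sum contains the factor `𝔹(ν)u = 0`. In the second, the same relation
allows `eᵢ` to be replaced by its tangential part. Differentiating `𝔹(N)u = 0` along `∂Ω` gives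
`-𝔹(ν)∂_τ u = 𝔹(∂_τ N)u`, and the outcome is the Levi form (`IsC2Domain.sum_boundary_eq`).

Three analytic facts support this algebra. The divergence theorem with Hausdorff surface measure
(`IsC2Domain.integral_fderiv_eq`) comes from Fubini in graph coordinates, the area formula and a
partition of unity. Since `u` is only `C¹`, the null Lagrangian identity is proved for `C²`
functions and carried over by approximation in the `C¹` norm (`IsC2Domain.exists_contDiff_approx`):
cut off, shift into the domain, mollify. This suffices because both sides contain only first
derivatives. Finally, `u` need not be differentiable across `∂Ω`, so the chain rule along boundary
curves (`IsC2Domain.exists_curve`) is obtained by pushing the curve into `Ω`. -/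

/-! ### Local comparison of measures; Hausdorff measure of images -/

/-- A measure which is locally dominated by `c • μ` for each `c > 1` is dominated by `μ`. -/
theorem measure_le_of_forall_locally_le {X : Type*} [TopologicalSpace X] [MeasurableSpace X]
    [OpensMeasurableSpace X] [SecondCountableTopology X] {μ ν : Measure X}
    (h : ∀ c : ℝ, 1 < c → ∀ x : X, ∃ V ∈ 𝓝 x, ∀ s ⊆ V, MeasurableSet s →
      ν s ≤ ENNReal.ofReal c * μ s) : ν ≤ μ := by
  have key : ∀ c : ℝ, 1 < c → ∀ s, MeasurableSet s → ν s ≤ ENNReal.ofReal c * μ s := by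
    intro c hc s hs
    choose V hV hVs using h c hc
    -- By second countability, countably many of the good neighbourhoods cover the space. Made
    -- disjoint, they let the local inequalities be summed.
    obtain ⟨t, htc, ht⟩ := TopologicalSpace.countable_cover_nhds
      (fun x => interior_mem_nhds.2 (hV x))
    rcases t.eq_empty_or_nonempty with rfl | hne
    · have : s = ∅ := by
        rw [← Set.univ_inter s, ← ht]; simp
      simp [this]
    obtain ⟨g, rfl⟩ := htc.exists_eq_range hne
    set D : ℕ → Set X := disjointed (fun i => interior (V (g i))) with hD
    have hDm : ∀ i, MeasurableSet (D i) :=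
      fun i => MeasurableSet.disjointed (fun i => isOpen_interior.measurableSet) i
    have hDd : Pairwise (Function.onFun Disjoint D) := disjoint_disjointed _
    have hDu : ⋃ i, D i = Set.univ := by
      rw [hD, iUnion_disjointed, ← ht]; simp
    have hsum : ∀ m : Measure X, m s = ∑' i, m (s ∩ D i) := by
      intro m
      rw [← measure_iUnion (fun i j hij => (hDd hij).mono Set.inter_subset_right
        Set.inter_subset_right) (fun i => hs.inter (hDm i)), ← Set.inter_iUnion, hDu, Set.inter_univ]
    rw [hsum ν, hsum μ, ← ENNReal.tsum_mul_left]
    refine ENNReal.tsum_le_tsum fun i => hVs (g i) _ ?_ (hs.inter (hDm i))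
    exact Set.inter_subset_right.trans ((disjointed_subset _ i).trans interior_subset)
  refine Measure.le_iff.2 fun s hs => ?_
  -- Let `c` decrease to `1`. The limit of the factor is nonzero, so the product converges even when
  -- `μ s = ∞`.
  have htend : Filter.Tendsto (fun c : ℝ => ENNReal.ofReal c * μ s) (𝓝[>] 1) (𝓝 (μ s)) := by
    have h1 : Filter.Tendsto (fun c : ℝ => ENNReal.ofReal c) (𝓝[>] 1) (𝓝 1) := by
      simpa using (ENNReal.continuous_ofReal.tendsto 1).mono_left nhdsWithin_le_nhds
    simpa using ENNReal.Tendsto.mul_const h1 (Or.inl one_ne_zero)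
  exact ge_of_tendsto htend (by filter_upwards [self_mem_nhdsWithin] with c hc using key c hc s hs)

theorem LipschitzOnWith.euclideanHausdorffMeasure_image_le {X Y : Type*} [MetricSpace X]
    [MeasurableSpace X] [BorelSpace X] [MetricSpace Y] [MeasurableSpace Y] [BorelSpace Y]
    {K : NNReal} {f : X → Y} {s : Set X} (hf : LipschitzOnWith K f s) (d : ℕ) :
    μHE[d] (f '' s) ≤ (K : ENNReal) ^ d * μHE[d] s := by
  have := hf.hausdorffMeasure_image_le (d := d) (by positivity)
  rw [ENNReal.rpow_natCast] at this
  simp_rw [Measure.euclideanHausdorffMeasure_def, Measure.smul_apply,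
    Measure.nnreal_smul_coe_apply]
  calc _ ≤ _ := mul_le_mul_right this _
    _ = _ := mul_left_comm _ _ _

/-- If distances after `f` are controlled by those after `g`, so are Hausdorff measures. -/
theorem euclideanHausdorffMeasure_image_le_of_dist_le {X Y Z : Type*}
    [MetricSpace Y] [MeasurableSpace Y] [BorelSpace Y] [MetricSpace Z] [MeasurableSpace Z]
    [BorelSpace Z] {K : NNReal} {f : X → Y} {g : X → Z} {s : Set X}
    (h : ∀ x ∈ s, ∀ y ∈ s, dist (f x) (f y) ≤ K * dist (g x) (g y)) (d : ℕ) :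
    μHE[d] (f '' s) ≤ (K : ENNReal) ^ d * μHE[d] (g '' s) := by
  rcases s.eq_empty_or_nonempty with rfl | ⟨x₀, hx₀⟩
  · simp
  have : Nonempty X := ⟨x₀⟩
  -- The hypothesis forces `f` to agree at points of `s` with equal `g`. Hence `f` factors through
  -- `g` on `s`, and the factor `k` is `K`-Lipschitz on `g '' s`.
  set k := f ∘ Function.invFunOn g s
  have hk : ∀ x ∈ s, k (g x) = f x := by
    intro x hx
    have h1 : ∃ a ∈ s, g a = g x := ⟨x, hx, rfl⟩
    have := h _ (Function.invFunOn_mem h1) x hx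
    rw [Function.invFunOn_eq h1, dist_self, mul_zero] at this
    exact dist_le_zero.1 this
  have hL : LipschitzOnWith K k (g '' s) := by
    refine LipschitzOnWith.of_dist_le_mul ?_
    rintro _ ⟨x, hx, rfl⟩ _ ⟨y, hy, rfl⟩
    rw [hk x hx, hk y hy]
    exact h x hx y hy
  have himg : f '' s = k '' (g '' s) := by
    rw [Set.image_image]
    exact (Set.image_congr hk).symm
  rw [himg]
  exact hL.euclideanHausdorffMeasure_image_le d

/-! ### Area formula for injective immersions -/

section AreaFormula

variable {U W : Type*} [NormedAddCommGroup U] [InnerProductSpace ℝ U] [FiniteDimensional ℝ U]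
  [NormedAddCommGroup W] [InnerProductSpace ℝ W]

/-- The square of `normDet L` is the Gram determinant `det (L* L)`, which depends continuously on
`L`. -/
theorem continuous_normDet [CompleteSpace W] :
    Continuous fun L : U →L[ℝ] W => L.toLinearMap.normDet := by
  have : CompleteSpace U := FiniteDimensional.complete ℝ U
  have h : ∀ L : U →L[ℝ] W, L.toLinearMap.normDet =
      √((ContinuousLinearMap.adjoint L ∘L L).det) := by
    intro L
    rw [← ContinuousLinearMap.normDet_sq]
    simp [Real.sqrt_sq (LinearMap.normDet_nonneg _)]
  simp_rw [h]
  refine Real.continuous_sqrt.comp (ContinuousLinearMap.continuous_det.comp ?_)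
  fun_prop

theorem normDet_pos_of_injective {L : U →L[ℝ] W} (hL : Function.Injective L) :
    0 < L.toLinearMap.normDet := by
  refine lt_of_le_of_ne (LinearMap.normDet_nonneg _) (Ne.symm ?_)
  exact (L.toLinearMap.normDet_ne_zero_tfae.out 0 4).2 hL

/-- A `C¹` immersion is locally almost isometric to its differential. -/
theorem HasStrictFDerivAt.exists_dist_le_mul {f : U → W} {L : U →L[ℝ] W} {x : U}
    (hf : HasStrictFDerivAt f L x) (hL : Function.Injective L) {K : ℝ} (hK : 1 < K) :
    ∃ V ∈ 𝓝 x, ∀ y ∈ V, ∀ z ∈ V, dist (f y) (f z) ≤ K * dist (L y) (L z) ∧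
      dist (L y) (L z) ≤ K * dist (f y) (f z) := by
  obtain ⟨c, hc, hcL⟩ := L.toLinearMap.exists_antilipschitzWith (LinearMap.ker_eq_bot.2 hL)
  have hc' : (0 : ℝ) < c := hc
  -- This value serves both inequalities: `1 + ε ≤ K` and `K (1 - ε) = 1`.
  set ε : ℝ := (K - 1) / K with hε
  have hK0 : 0 < K := by linarith
  have hε0 : 0 < ε := div_pos (by linarith) hK0
  have h1 : 1 + ε ≤ K := by
    rw [hε]; 
    have : 1 + (K - 1) / K = K - (K - 1) ^ 2 / K := by field_simp; ring
    rw [this]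
    have : 0 ≤ (K - 1) ^ 2 / K := by positivity
    linarith
  have h2 : K * (1 - ε) = 1 := by rw [hε]; field_simp; ring
  -- Since `‖y - z‖ ≤ c ‖L y - L z‖`, the tolerance `ε / c` bounds the linearization error by `ε ‖L
  -- y - L z‖`, that is, relative to the quantity being compared.
  have hlo := hf.isLittleO.def (show 0 < ε / c by positivity)
  rw [nhds_prod_eq, Filter.eventually_prod_self_iff'] at hlo
  obtain ⟨V, hV, hlo⟩ := hlo
  refine ⟨V, hV, fun y hy z hz => ?_⟩
  have h3 := hlo y hy z hz
  have h4 : ‖y - z‖ ≤ c * ‖L y - L z‖ := by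
    simpa [dist_eq_norm] using hcL.le_mul_dist y z
  have h5 : ‖f y - f z - L (y - z)‖ ≤ ε * ‖L y - L z‖ := by
    refine h3.trans ?_
    calc ε / c * ‖y - z‖ ≤ ε / c * (c * ‖L y - L z‖) := by gcongr
      _ = _ := by field_simp
  rw [map_sub] at h5
  rw [dist_eq_norm, dist_eq_norm]
  have h6 := norm_sub_norm_le (f y - f z) (L y - L z)
  have h7 := norm_sub_norm_le (L y - L z) (f y - f z)
  rw [norm_sub_rev (L y - L z)] at h7
  have h8 := norm_nonneg (L y - L z)
  constructor
  · nlinarith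
  · have : (1 - ε) * ‖L y - L z‖ ≤ ‖f y - f z‖ := by linarith
    calc ‖L y - L z‖ = K * ((1 - ε) * ‖L y - L z‖) := by rw [← mul_assoc, h2, one_mul]
      _ ≤ _ := by gcongr

theorem exists_one_lt_pow_le (d : ℕ) {c : ℝ} (hc : 1 < c) : ∃ K : ℝ, 1 < K ∧ K ^ d ≤ c := by
  have h : ∀ᶠ K : ℝ in 𝓝[>] 1, K ^ d < c := by
    have : Filter.Tendsto (fun K : ℝ => K ^ d) (𝓝[>] 1) (𝓝 1) := by
      simpa using ((continuous_pow (M := ℝ) d).tendsto 1).mono_left nhdsWithin_le_nhds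
    exact this.eventually_lt_const hc
  obtain ⟨K, hK, hK1⟩ := (h.and self_mem_nhdsWithin).exists
  exact ⟨K, hK1, hK.le⟩

variable [MeasurableSpace U] [BorelSpace U] [MeasurableSpace W] [BorelSpace W]

/-- **Area formula** for an injective `C¹` immersion. -/
theorem comap_euclideanHausdorffMeasure_eq_withDensity [CompleteSpace W] {f : U → W}
    (hf : ContDiff ℝ 1 f) (hinj : Function.Injective f)
    (hf' : ∀ x, Function.Injective (fderiv ℝ f x)) :
    Measure.comap f μHE[Module.finrank ℝ U] =
      volume.withDensity fun x => ENNReal.ofReal (fderiv ℝ f x).toLinearMap.normDet := by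
  have : CompleteSpace U := FiniteDimensional.complete ℝ U
  set d := Module.finrank ℝ U
  have hemb : MeasurableEmbedding f := hf.continuous.measurableEmbedding hinj
  set J : U → ℝ := fun x => (fderiv ℝ f x).toLinearMap.normDet with hJ
  have hJc : Continuous J := continuous_normDet.comp (hf.continuous_fderiv (by norm_num))
  have hJpos : ∀ x, 0 < J x := fun x => normDet_pos_of_injective (hf' x)
  have hloc : ∀ c : ℝ, 1 < c → ∀ x : U, ∃ V ∈ 𝓝 x, ∀ s ⊆ V, MeasurableSet s →
      μHE[d] (f '' s) ≤ ENNReal.ofReal c * ∫⁻ y in s, ENNReal.ofReal (J y) ∧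
      ∫⁻ y in s, ENNReal.ofReal (J y) ≤ ENNReal.ofReal c * μHE[d] (f '' s) := by
    intro c hc x
    -- Of the `d + 1` factors `K`, `d` pay for replacing `f` by its differential in the Hausdorff
    -- measure, and one pays for the variation of `J` near `x`.
    obtain ⟨K, hK1, hKc⟩ := exists_one_lt_pow_le (d + 1) hc
    have hK0 : 0 < K := by linarith
    obtain ⟨V, hV, hd⟩ := (hf.contDiffAt.hasStrictFDerivAt (by norm_num)
      : HasStrictFDerivAt f (fderiv ℝ f x) x).exists_dist_le_mul (hf' x) hK1
    have hJ1 : ∀ᶠ y in 𝓝 x, J y < K * J x := 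
      hJc.continuousAt.eventually_lt_const (by have := hJpos x; nlinarith)
    have hJ2 : ∀ᶠ y in 𝓝 x, J x < K * J y := 
      (hJc.const_mul K).continuousAt.eventually_const_lt (by have := hJpos x; nlinarith)
    refine ⟨V ∩ ({y | J y < K * J x} ∩ {y | J x < K * J y}),
      Filter.inter_mem hV (Filter.inter_mem hJ1 hJ2), fun s hs hsm => ?_⟩
    have hKn := (ENNReal.ofReal_eq_coe_nnreal hK0.le).symm
    have e1 := euclideanHausdorffMeasure_image_le_of_dist_le (K := NNReal.mk K hK0.le)
      (fun y hy z hz => (hd y (hs hy).1 z (hs hz).1).1) d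
    have e2 := euclideanHausdorffMeasure_image_le_of_dist_le (K := NNReal.mk K hK0.le)
      (fun y hy z hz => (hd y (hs hy).1 z (hs hz).1).2) d
    rw [hKn, ← ENNReal.ofReal_pow hK0.le] at e1 e2
    have hlin := (fderiv ℝ f x).toLinearMap.euclideanHausdorffMeasure_image_eq_normDet_mul_volume s
    change μHE[d] ((fderiv ℝ f x) '' s) = ENNReal.ofReal (J x) * volume s at hlin
    rw [hlin] at e1 e2
    have i1 : ENNReal.ofReal (J x) * volume s ≤ 
        ENNReal.ofReal K * ∫⁻ y in s, ENNReal.ofReal (J y) := by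
      rw [← lintegral_const_mul _ (by fun_prop), ← setLIntegral_const]
      refine setLIntegral_mono (by fun_prop) fun y hy => ?_
      rw [← ENNReal.ofReal_mul hK0.le]
      exact ENNReal.ofReal_le_ofReal (hs hy).2.2.le
    have i2 : ∫⁻ y in s, ENNReal.ofReal (J y) ≤ 
        ENNReal.ofReal K * (ENNReal.ofReal (J x) * volume s) := by
      rw [← mul_assoc, ← ENNReal.ofReal_mul hK0.le, ← setLIntegral_const]
      refine setLIntegral_mono (by fun_prop) fun y hy => ?_
      exact ENNReal.ofReal_le_ofReal (hs hy).2.1.le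
    have hcc : ENNReal.ofReal (K ^ d) * ENNReal.ofReal K ≤ ENNReal.ofReal c := by
      rw [← ENNReal.ofReal_mul (by positivity), ← pow_succ]
      exact ENNReal.ofReal_le_ofReal hKc
    constructor
    · calc _ ≤ _ := e1
        _ ≤ ENNReal.ofReal (K ^ d) * (ENNReal.ofReal K * ∫⁻ y in s, ENNReal.ofReal (J y)) := by
          gcongr
        _ ≤ _ := by rw [← mul_assoc]; gcongr
    · calc _ ≤ _ := i2
        _ ≤ ENNReal.ofReal K * (ENNReal.ofReal (K ^ d) * μHE[d] (f '' s)) := by gcongr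
        _ ≤ _ := by rw [← mul_assoc, mul_comm (ENNReal.ofReal K)]; gcongr
  apply le_antisymm
  · refine measure_le_of_forall_locally_le fun c hc x => ?_
    obtain ⟨V, hV, h⟩ := hloc c hc x
    refine ⟨V, hV, fun s hs hsm => ?_⟩
    rw [hemb.comap_apply, withDensity_apply _ hsm]
    exact (h s hs hsm).1
  · refine measure_le_of_forall_locally_le fun c hc x => ?_
    obtain ⟨V, hV, h⟩ := hloc c hc x
    refine ⟨V, hV, fun s hs hsm => ?_⟩
    rw [hemb.comap_apply, withDensity_apply _ hsm]
    exact (h s hs hsm).2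

end AreaFormula

/-! ### Graph coordinates and integration over an epigraph -/

section Graph

/-- The hyperplane orthogonal to `e`. -/
noncomputable abbrev perp {W : Type*} [NormedAddCommGroup W] [InnerProductSpace ℝ W] (e : W) : Submodule ℝ W :=
  (Submodule.span ℝ {e})ᗮ

variable {W : Type*} [NormedAddCommGroup W] [InnerProductSpace ℝ W] {e : W}

theorem orthogonalProjectionOnto_add_smul (y : (perp e)) (t : ℝ) :
    (perp e).orthogonalProjectionOnto ((y : W) + t • e) = y := by
  have hPe : (perp e).orthogonalProjectionOnto e = 0 := by
    rw [Submodule.orthogonalProjectionOnto_eq_zero_iff, Submodule.orthogonal_orthogonal]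
    exact Submodule.mem_span_singleton_self e
  rw [map_add, map_smul, hPe, smul_zero, add_zero,
    Submodule.orthogonalProjectionOnto_mem_subspace_eq_self]

theorem inner_orthogonal_span_singleton (y : (perp e)) : ⟪e, (y : W)⟫_ℝ = 0 :=
  Submodule.mem_orthogonal_singleton_iff_inner_right.1 y.2

theorem inner_add_smul_self (he : ‖e‖ = 1) (y : (perp e)) (t : ℝ) :
    ⟪e, (y : W) + t • e⟫_ℝ = t := by
  rw [inner_add_right, inner_orthogonal_span_singleton, inner_smul_right,
    real_inner_self_eq_norm_sq, he]
  ring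

theorem orthogonalProjectionOnto_add_inner_smul (he : ‖e‖ = 1) (x : W) :
    ((perp e).orthogonalProjectionOnto x : W) + ⟪e, x⟫_ℝ • e = x := by
  have h := Submodule.starProjection_add_starProjection_orthogonal (K := Submodule.span ℝ {e}) x
  rw [Submodule.starProjection_unit_singleton ℝ he] at h
  rw [add_comm]
  exact h

/-- The coordinates `(y, s) ↦ y + (γ y + s) e` adapted to the graph of `γ`. -/
noncomputable def graphHomeomorph (he : ‖e‖ = 1) {γ : (perp e) → ℝ}
    (hγ : Continuous γ) : (perp e) × ℝ ≃ₜ W where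
  toFun p := (p.1 : W) + (γ p.1 + p.2) • e
  invFun x := ((perp e).orthogonalProjectionOnto x,
    ⟪e, x⟫_ℝ - γ ((perp e).orthogonalProjectionOnto x))
  left_inv p := by
    simp only [orthogonalProjectionOnto_add_smul, inner_add_smul_self he, add_sub_cancel_left]
  right_inv x := by
    simp only [add_sub_cancel, orthogonalProjectionOnto_add_inner_smul he]
  continuous_toFun := by fun_prop
  continuous_invFun := by fun_prop

theorem graphHomeomorph_apply (he : ‖e‖ = 1) {γ : (perp e) → ℝ}
    (hγ : Continuous γ) (p : (perp e) × ℝ) :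
    graphHomeomorph he hγ p = (p.1 : W) + (γ p.1 + p.2) • e := rfl

theorem graphHomeomorph_symm_apply (he : ‖e‖ = 1) {γ : (perp e) → ℝ}
    (hγ : Continuous γ) (x : W) : (graphHomeomorph he hγ).symm x =
      ((perp e).orthogonalProjectionOnto x,
        ⟪e, x⟫_ℝ - γ ((perp e).orthogonalProjectionOnto x)) := rfl

/-- The region strictly above the graph of `γ`. -/
def epigraph (e : W) (γ : (perp e) → ℝ) : Set W :=
  {x | γ ((perp e).orthogonalProjectionOnto x) < ⟪e, x⟫_ℝ}

theorem preimage_epigraph (he : ‖e‖ = 1) {γ : (perp e) → ℝ} (hγ : Continuous γ) :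
    graphHomeomorph he hγ ⁻¹' epigraph e γ = Set.univ ×ˢ Set.Ioi 0 := by
  ext p
  simp [epigraph, graphHomeomorph_apply, orthogonalProjectionOnto_add_smul,
    inner_add_smul_self he, -map_add]

theorem isOpen_epigraph {γ : (perp e) → ℝ} (hγ : Continuous γ) :
    IsOpen (epigraph e γ) := isOpen_lt (by fun_prop) (by fun_prop)

theorem epigraph_eq_image (he : ‖e‖ = 1) {γ : (perp e) → ℝ} (hγ : Continuous γ) :
    epigraph e γ = graphHomeomorph he hγ '' (Set.univ ×ˢ Set.Ioi 0) := by
  rw [← preimage_epigraph he hγ, Set.image_preimage_eq _ (graphHomeomorph he hγ).surjective]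

theorem closure_epigraph (he : ‖e‖ = 1) {γ : (perp e) → ℝ} (hγ : Continuous γ) :
    closure (epigraph e γ) = graphHomeomorph he hγ '' (Set.univ ×ˢ Set.Ici 0) := by
  rw [epigraph_eq_image he hγ, ← (graphHomeomorph he hγ).image_closure, closure_prod_eq,
    closure_univ, closure_Ioi]

theorem frontier_epigraph (he : ‖e‖ = 1) {γ : (perp e) → ℝ} (hγ : Continuous γ) :
    frontier (epigraph e γ) = Set.range fun y : (perp e) => (y : W) + γ y • e := by
  rw [(isOpen_epigraph hγ).frontier_eq, closure_epigraph he hγ, epigraph_eq_image he hγ,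
    ← Set.image_sdiff (graphHomeomorph he hγ).injective]
  ext x
  constructor
  · rintro ⟨⟨y, s⟩, ⟨⟨-, h1⟩, h2⟩, rfl⟩
    have hs : s = 0 := by
      simp only [Set.mem_Ici, Set.mem_prod, Set.mem_univ, Set.mem_Ioi, true_and, not_lt] at h1 h2
      exact le_antisymm h2 h1
    exact ⟨y, by simp [graphHomeomorph_apply, hs]⟩
  · rintro ⟨y, rfl⟩
    exact ⟨(y, 0), by simp, by simp [graphHomeomorph_apply]⟩

theorem mem_closure_epigraph_iff {e : W} (he : ‖e‖ = 1) {γ : (perp e) → ℝ} (hγ : Continuous γ)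
    {x : W} : x ∈ closure (epigraph e γ) ↔
      0 ≤ ⟪e, x⟫_ℝ - γ ((perp e).orthogonalProjectionOnto x) := by
  rw [closure_epigraph he hγ, (graphHomeomorph he hγ).image_eq_preimage_symm]
  simp [graphHomeomorph_symm_apply]

variable [FiniteDimensional ℝ W] [MeasurableSpace W] [BorelSpace W]

/-- The map is a shear followed by the isometric identification of `eᗮ × ℝ` with `W`. The shear
translates each vertical line, so it preserves volume by Fubini, and continuity of `γ` is enough. -/
theorem measurePreserving_graphHomeomorph (he : ‖e‖ = 1) {γ : (perp e) → ℝ}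
    (hγ : Continuous γ) : MeasurePreserving (graphHomeomorph he hγ) volume volume := by
  have h1 : MeasurePreserving
      (fun p : (perp e) × ℝ => (p.1, γ p.1 + p.2)) volume volume :=
    (MeasurePreserving.id volume).skew_product (by fun_prop)
      (Filter.Eventually.of_forall fun y => (measurePreserving_add_left volume (γ y)).map_eq)
  have h2 := ((Submodule.span ℝ {e}).measurePreserving_measurableEquivProd (0 : W)).symm
  rw [InnerProductSpace.euclideanHausdorffMeasure_eq_volume] at h2
  have h3 : MeasurePreserving (Prod.map (LinearIsometryEquiv.toSpanUnitSingleton e he)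
      (id : (perp e) → (perp e))) volume volume :=
    (LinearIsometryEquiv.measurePreserving _).prod (MeasurePreserving.id _)
  have h4 := h2.comp (h3.comp (Measure.measurePreserving_swap.comp h1))
  have h5 : ⇑(graphHomeomorph he hγ) = ((Submodule.span ℝ {e}).measurableEquivProd 0).symm ∘
      Prod.map (LinearIsometryEquiv.toSpanUnitSingleton e he) id ∘ Prod.swap ∘
        fun p => (p.1, γ p.1 + p.2) := by
    funext p
    simp [graphHomeomorph_apply, add_comm]
  rw [h5]
  exact h4

/-- The integral of a directional derivative of a compactly supported function vanishes. -/
theorem integral_hasFDerivAt_eq_zero {f : W → ℝ} {f' : W → W →L[ℝ] ℝ}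
    (hf : ∀ x, HasFDerivAt f (f' x) x) (hf' : Continuous f') (hc : HasCompactSupport f) (w : W) :
    ∫ x, f' x w = 0 := by
  have hfc : Continuous f := continuous_iff_continuousAt.2 fun x => (hf x).continuousAt
  have hf'eq : f' = fderiv ℝ f := funext fun x => (hf x).fderiv.symm
  have hc' : HasCompactSupport fun x => f' x w := by
    rw [hf'eq]; exact hc.fderiv_apply ℝ w
  -- Integration by parts against the constant function `1`.
  have h := integral_bilinear_hasFDerivAt_right_eq_neg_left_of_integrable (μ := volume)
    (f := fun _ : W => (1 : ℝ)) (f' := fun _ => 0) (g := f) (g' := f') (v := w)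
    (B := ContinuousLinearMap.mul ℝ ℝ) (by simp)
    (by simpa using (hf'.clm_apply continuous_const).integrable_of_hasCompactSupport hc')
    (by simpa using hfc.integrable_of_hasCompactSupport hc)
    (fun x _ => hasFDerivAt_const _ _) (fun x _ => hf x)
  simpa using h

/-- Split `w` into the vector `P w + dγ(P w) e`, tangent to the translated graphs `s = const`, and a
multiple of `e`. The tangential derivative integrates to zero over every such graph. The derivative
along `e` is integrated over vertical half lines and leaves minus the value of `φ` on the graph. -/
theorem integral_epigraph_fderiv (he : ‖e‖ = 1) {γ : (perp e) → ℝ}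
    (hγ : ContDiff ℝ 1 γ) {φ : W → ℝ} (hφ : ContDiff ℝ 1 φ) (hc : HasCompactSupport φ) (w : W) :
    ∫ x in epigraph e γ, fderiv ℝ φ x w =
      ∫ y : (perp e), φ ((y : W) + γ y • e) *
        (fderiv ℝ γ y ((perp e).orthogonalProjectionOnto w) - ⟪e, w⟫_ℝ) := by
  set h := graphHomeomorph he hγ.continuous with hh
  set P := (perp e).orthogonalProjectionOnto with hP
  have hmp := measurePreserving_graphHomeomorph he hγ.continuous
  have hφ' : Continuous (fderiv ℝ φ) := hφ.continuous_fderiv (by norm_num)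
  have hγ' : Continuous (fderiv ℝ γ) := hγ.continuous_fderiv (by norm_num)
  have hcf : HasCompactSupport (fderiv ℝ φ) := hc.fderiv ℝ
  have hch : HasCompactSupport fun p => fderiv ℝ φ (h p) := hcf.comp_homeomorph h
  -- derivatives in the graph coordinates
  have hds : ∀ y s, HasDerivAt (fun s : ℝ => φ (h (y, s))) (fderiv ℝ φ (h (y, s)) e) s := by
    intro y s
    have h1 : HasDerivAt (fun s : ℝ => h (y, s)) e s := by
      simpa [hh, graphHomeomorph_apply] using
        (((hasDerivAt_id s).const_add (γ y)).smul_const e).const_add (y : W)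
    exact ((hφ.differentiable (by norm_num)) _).hasFDerivAt.comp_hasDerivAt s h1
  have hdy : ∀ (s : ℝ) (y : (perp e)), HasFDerivAt (fun y : (perp e) => φ (h (y, s)))
      ((fderiv ℝ φ (h (y, s))).comp ((perp e).subtypeL + (fderiv ℝ γ y).smulRight e)) y := by
    intro s y
    have h1 : HasFDerivAt (fun y : (perp e) => h (y, s)) ((perp e).subtypeL + (fderiv ℝ γ y).smulRight e) y := by
      have h2 : HasFDerivAt γ (fderiv ℝ γ y) y :=
        ((hγ.differentiable (by norm_num)) y).hasFDerivAt
      exact (perp e).subtypeL.hasFDerivAt.add ((h2.add_const s).smul_const e)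
    exact ((hφ.differentiable (by norm_num)) _).hasFDerivAt.comp y h1
  have hint : ∀ k : (perp e) × ℝ → W, Continuous k → Integrable (fun p => fderiv ℝ φ (h p) (k p))
      ((volume : Measure (perp e)).prod (volume : Measure ℝ)) := by
    intro k hk
    refine Continuous.integrable_of_hasCompactSupport (μ := (volume : Measure ((perp e) × ℝ))) ?_ ?_
    · exact (hφ'.comp h.continuous).clm_apply hk
    · refine hch.mono fun p hp => ?_
      contrapose! hp
      simp only [Function.mem_support, not_not] at hp ⊢
      simp [hp]
  have hres : (volume.restrict (Set.univ ×ˢ Set.Ioi 0) : Measure ((perp e) × ℝ)) =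
      (volume : Measure (perp e)).prod (volume.restrict (Set.Ioi (0 : ℝ))) := by
    rw [Measure.volume_eq_prod, ← Measure.prod_restrict, Measure.restrict_univ]
  have hint' : ∀ k : (perp e) × ℝ → W, Continuous k → Integrable (fun p => fderiv ℝ φ (h p) (k p))
      ((volume : Measure (perp e)).prod (volume.restrict (Set.Ioi (0 : ℝ)))) := by
    intro k hk
    rw [← hres]
    exact (hint k hk).integrableOn
  -- the transversal direction
  have hline : ∀ y : (perp e), ∫ s in Set.Ioi (0 : ℝ), fderiv ℝ φ (h (y, s)) e =
      - φ ((y : W) + γ y • e) := by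
    intro y
    have hcs : HasCompactSupport fun s : ℝ => φ (h (y, s)) := by
      have : Topology.IsClosedEmbedding fun s : ℝ => h (y, s) :=
        h.isClosedEmbedding.comp (Topology.IsClosedEmbedding.of_continuous_injective_isClosedMap
          (by fun_prop) (fun a b hab => by simpa using hab)
          (isClosedMap_prodMk_left y))
      exact hc.comp_isClosedEmbedding this
    have hcs' : HasCompactSupport fun s : ℝ => fderiv ℝ φ (h (y, s)) e := by
      have : (fun s : ℝ => fderiv ℝ φ (h (y, s)) e) = deriv fun s : ℝ => φ (h (y, s)) :=
        funext fun s => (hds y s).deriv.symm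
      rw [this]; exact hcs.deriv
    have hcont : Continuous fun s : ℝ => fderiv ℝ φ (h (y, s)) e :=
      (hφ'.comp (h.continuous.comp (by fun_prop))).clm_apply continuous_const
    have := integral_Ioi_of_hasDerivAt_of_tendsto (a := (0 : ℝ)) (m := 0)
      (hds y 0).continuousAt.continuousWithinAt (fun s _ => hds y s)
      (hcont.integrable_of_hasCompactSupport hcs').integrableOn
      (by
        have := hcs.is_zero_at_infty
        exact this.mono_left atTop_le_cocompact)
    rw [this]
    simp [hh, graphHomeomorph_apply]
  -- the tangential directions
  have htan : ∀ v : (perp e), ∫ p, fderiv ℝ φ (h p) ((v : W) + fderiv ℝ γ p.1 v • e)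
      ∂((volume : Measure (perp e)).prod (volume.restrict (Set.Ioi (0 : ℝ)))) = 0 := by
    intro v
    rw [integral_prod_symm _ (hint' _ (by fun_prop))]
    refine integral_eq_zero_of_ae (Filter.Eventually.of_forall fun s => ?_)
    have hcs : HasCompactSupport fun y : (perp e) => φ (h (y, s)) := by
      have : Topology.IsClosedEmbedding fun y : (perp e) => h (y, s) :=
        h.isClosedEmbedding.comp (Topology.IsClosedEmbedding.of_continuous_injective_isClosedMap
          (by fun_prop) (fun a b hab => by simpa using hab)
          (isClosedMap_prodMk_right s))
      exact hc.comp_isClosedEmbedding this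
    refine Eq.trans ?_ (integral_hasFDerivAt_eq_zero (hdy s) ?_ hcs v)
    · simp
    · refine (hφ'.comp (h.continuous.comp (by fun_prop))).clm_comp ?_
      exact continuous_const.add
        (((ContinuousLinearMap.smulRightL ℝ (perp e) W).flip e).continuous.comp hγ')
  have hsplit : ∀ p : (perp e) × ℝ, fderiv ℝ φ (h p) w =
      fderiv ℝ φ (h p) ((P w : W) + fderiv ℝ γ p.1 (P w) • e) -
        (fderiv ℝ γ p.1 (P w) - ⟪e, w⟫_ℝ) * fderiv ℝ φ (h p) e := by
    intro p
    conv_lhs => rw [← orthogonalProjectionOnto_add_inner_smul he w]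
    simp only [map_add, map_smul, smul_eq_mul]
    ring
  rw [← hmp.setIntegral_preimage_emb h.measurableEmbedding, preimage_epigraph he hγ.continuous,
    hres]
  have hint2 : Integrable (fun p : (perp e) × ℝ =>
      (fderiv ℝ γ p.1 (P w) - ⟪e, w⟫_ℝ) * fderiv ℝ φ (h p) e)
      ((volume : Measure (perp e)).prod (volume.restrict (Set.Ioi (0 : ℝ)))) := by
    have := hint' (fun p => (fderiv ℝ γ p.1 (P w) - ⟪e, w⟫_ℝ) • e) (by fun_prop)
    simpa using this
  change ∫ p, fderiv ℝ φ (h p) w ∂_ = _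
  simp_rw [hsplit]
  rw [integral_sub (hint' _ (by fun_prop)) hint2, htan, zero_sub, integral_prod _ hint2,
    ← integral_neg]
  congr 1
  funext y
  change -∫ s in Set.Ioi (0 : ℝ), (fderiv ℝ γ y (P w) - ⟪e, w⟫_ℝ) * fderiv ℝ φ (h (y, s)) e = _
  rw [integral_const_mul, hline]
  ring

end Graph

/-! ### Surface measure and unit normal of a graph -/

section GraphSurface

variable {W : Type*} [NormedAddCommGroup W] [InnerProductSpace ℝ W] {e : W}

/-- The area density `√(1 + |∇γ|²)` of the graph of `γ`. -/
noncomputable def graphDensity (γ : (perp e) → ℝ) (y : (perp e)) : ℝ :=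
  √(1 + ‖fderiv ℝ γ y‖ ^ 2)

theorem graphDensity_pos (γ : (perp e) → ℝ) (y : (perp e)) : 0 < graphDensity γ y :=
  Real.sqrt_pos.2 (by positivity)

/-- The graph of `γ` as a parametrized surface. -/
noncomputable def graphMap (γ : (perp e) → ℝ) (y : (perp e)) : W := (y : W) + γ y • e

theorem hasFDerivAt_graphMap {γ : (perp e) → ℝ} (hγ : ContDiff ℝ 1 γ) (y : (perp e)) :
    HasFDerivAt (graphMap γ) ((perp e).subtypeL + (fderiv ℝ γ y).smulRight e) y :=
  (perp e).subtypeL.hasFDerivAt.add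
    (((hγ.differentiable (by norm_num)) y).hasFDerivAt.smul_const e)

theorem contDiff_graphMap {γ : (perp e) → ℝ} (hγ : ContDiff ℝ 1 γ) : ContDiff ℝ 1 (graphMap γ) :=
  (perp e).subtypeL.contDiff.add (hγ.smul contDiff_const)

theorem injective_graphMap (γ : (perp e) → ℝ) : Function.Injective (graphMap γ) := by
  intro y z h
  have := congrArg (perp e).orthogonalProjectionOnto h
  rwa [graphMap, graphMap, orthogonalProjectionOnto_add_smul,
    orthogonalProjectionOnto_add_smul] at this

theorem injective_fderiv_graphMap {γ : (perp e) → ℝ} (hγ : ContDiff ℝ 1 γ) (y : (perp e)) :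
    Function.Injective (fderiv ℝ (graphMap γ) y) := by
  rw [(hasFDerivAt_graphMap hγ y).fderiv]
  intro v w h
  have := congrArg (perp e).orthogonalProjectionOnto h
  simpa only [add_apply, ContinuousLinearMap.smulRight_apply,
    Submodule.subtypeL_apply, orthogonalProjectionOnto_add_smul] using this

theorem continuous_graphDensity {γ : (perp e) → ℝ} (hγ : ContDiff ℝ 1 γ) :
    Continuous (graphDensity γ) := by
  have : Continuous fun y => ‖fderiv ℝ γ y‖ :=
    continuous_norm.comp (hγ.continuous_fderiv (by norm_num))
  unfold graphDensity
  fun_prop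

variable [FiniteDimensional ℝ W]

/-- The unit normal `(∇γ - e) / √(1 + |∇γ|²)` of the graph of `γ`, pointing downwards. -/
noncomputable def graphNormal (γ : (perp e) → ℝ) (y : (perp e)) : W :=
  (graphDensity γ y)⁻¹ • (((InnerProductSpace.toDual ℝ (perp e)).symm (fderiv ℝ γ y) : W) - e)

/-- The area density cancels the normalization of the normal. This identifies the weight in
`integral_epigraph_fderiv` as normal component times surface element. -/
theorem graphDensity_mul_inner_graphNormal (γ : (perp e) → ℝ) (y : (perp e)) (w : W) :
    graphDensity γ y * ⟪graphNormal γ y, w⟫_ℝ =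
      fderiv ℝ γ y ((perp e).orthogonalProjectionOnto w) - ⟪e, w⟫_ℝ := by
  rw [graphNormal, real_inner_smul_left, mul_inv_cancel_left₀ (graphDensity_pos γ y).ne',
    inner_sub_left, ← InnerProductSpace.toDual_symm_apply (𝕜 := ℝ),
    Submodule.inner_orthogonalProjectionOnto_eq_of_mem_left]

theorem norm_graphNormal (he : ‖e‖ = 1) (γ : (perp e) → ℝ) (y : (perp e)) :
    ‖graphNormal γ y‖ = 1 := by
  have hn : ‖((InnerProductSpace.toDual ℝ (perp e)).symm (fderiv ℝ γ y) : W)‖ = ‖fderiv ℝ γ y‖ :=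
    (InnerProductSpace.toDual ℝ (perp e)).symm.norm_map _
  have h : ‖((InnerProductSpace.toDual ℝ (perp e)).symm (fderiv ℝ γ y) : W) - e‖ =
      graphDensity γ y := by
    rw [graphDensity, eq_comm, Real.sqrt_eq_iff_mul_self_eq (by positivity) (norm_nonneg _),
      ← sq, norm_sub_sq_real, real_inner_comm, inner_orthogonal_span_singleton, he, hn]
    ring
  rw [graphNormal, norm_smul, h, norm_inv, Real.norm_of_nonneg (graphDensity_pos γ y).le,
    inv_mul_cancel₀ (graphDensity_pos γ y).ne']

/-- As `e` is orthogonal to `eᗮ`, the Gram operator `L* L` is the identity plus the rank one map `v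
↦ ℓ(v) g`, where `g` represents `ℓ = dγ`. Its determinant is `1 + ℓ(g) = 1 + ‖ℓ‖²`. -/
theorem normDet_fderiv_graphMap (he : ‖e‖ = 1) {γ : (perp e) → ℝ} (hγ : ContDiff ℝ 1 γ)
    (y : (perp e)) : (fderiv ℝ (graphMap γ) y).toLinearMap.normDet = graphDensity γ y := by
  rw [(hasFDerivAt_graphMap hγ y).fderiv]
  set ℓ := fderiv ℝ γ y
  set L : (perp e) →L[ℝ] W := (perp e).subtypeL + ℓ.smulRight e with hL
  set g := (InnerProductSpace.toDual ℝ (perp e)).symm ℓ with hg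
  have hgi : ∀ v, ⟪g, v⟫_ℝ = ℓ v := fun v => InnerProductSpace.toDual_symm_apply
  have hinner : ∀ v v' : (perp e), ⟪L v, L v'⟫_ℝ = ⟪v, v'⟫_ℝ + ℓ v * ℓ v' := by
    intro v v'
    simp only [hL, add_apply, ContinuousLinearMap.smulRight_apply,
      Submodule.subtypeL_apply, inner_add_left, inner_add_right, real_inner_smul_left,
      inner_smul_right, inner_orthogonal_span_singleton, real_inner_self_eq_norm_sq, he,
      real_inner_comm e, Submodule.coe_inner]
    ring
  have hadj : ((ContinuousLinearMap.adjoint L ∘L L : (perp e) →L[ℝ] (perp e)) :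
      (perp e) →ₗ[ℝ] (perp e)) = LinearMap.transvection (ℓ : (perp e) →ₗ[ℝ] ℝ) g := by
    ext1 v
    refine ext_inner_right ℝ fun v' => ?_
    rw [LinearMap.transvection.apply]
    simp [ContinuousLinearMap.adjoint_inner_left, hinner, inner_add_left, real_inner_smul_left, hgi,
      -Submodule.coe_inner]
  have hsq := ContinuousLinearMap.normDet_sq L
  rw [ContinuousLinearMap.det, hadj, LinearMap.transvection.det] at hsq
  have hgg : ℓ g = ‖ℓ‖ ^ 2 := by
    rw [← hgi, real_inner_self_eq_norm_sq, hg, LinearIsometryEquiv.norm_map]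
  rw [graphDensity, eq_comm, Real.sqrt_eq_iff_mul_self_eq (by positivity)
    (LinearMap.normDet_nonneg _), ← sq, ← hgg]
  exact hsq.symm

variable [MeasurableSpace W] [BorelSpace W]

theorem measurableEmbedding_graphMap {γ : (perp e) → ℝ} (hγ : ContDiff ℝ 1 γ) :
    MeasurableEmbedding (graphMap γ) :=
  (contDiff_graphMap hγ).continuous.measurableEmbedding (injective_graphMap γ)

theorem restrict_range_graphMap (he : ‖e‖ = 1) {γ : (perp e) → ℝ} (hγ : ContDiff ℝ 1 γ) :
    (μHE[Module.finrank ℝ (perp e)] : Measure W).restrict (Set.range (graphMap γ)) =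
      Measure.map (graphMap γ)
        (volume.withDensity fun y => ENNReal.ofReal (graphDensity γ y)) := by
  have h := comap_euclideanHausdorffMeasure_eq_withDensity (contDiff_graphMap hγ)
    (injective_graphMap γ) (injective_fderiv_graphMap hγ)
  simp_rw [normDet_fderiv_graphMap he hγ] at h
  rw [← h, (measurableEmbedding_graphMap hγ).map_comap]

theorem setIntegral_range_graphMap (he : ‖e‖ = 1) {γ : (perp e) → ℝ} (hγ : ContDiff ℝ 1 γ)
    (f : W → ℝ) : ∫ x in Set.range (graphMap γ), f x ∂μHE[Module.finrank ℝ (perp e)] =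
      ∫ y, graphDensity γ y * f (graphMap γ y) := by
  rw [restrict_range_graphMap he hγ, (measurableEmbedding_graphMap hγ).integral_map,
    integral_withDensity_eq_integral_toReal_smul
      ((continuous_graphDensity hγ).measurable.ennreal_ofReal)
      (Filter.Eventually.of_forall fun _ => ENNReal.ofReal_lt_top)]
  simp_rw [ENNReal.toReal_ofReal (graphDensity_pos γ _).le, smul_eq_mul]

/-- **Divergence theorem** for the region above the graph of a `C¹` function. -/
theorem integral_epigraph_fderiv_eq_integral_graph (he : ‖e‖ = 1) {γ : (perp e) → ℝ}
    (hγ : ContDiff ℝ 1 γ) {φ : W → ℝ} (hφ : ContDiff ℝ 1 φ) (hc : HasCompactSupport φ) (w : W) :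
    ∫ x in epigraph e γ, fderiv ℝ φ x w = ∫ x in Set.range (graphMap γ),
      φ x * ⟪graphNormal γ ((perp e).orthogonalProjectionOnto x), w⟫_ℝ
        ∂μHE[Module.finrank ℝ (perp e)] := by
  rw [integral_epigraph_fderiv he hγ hφ hc, setIntegral_range_graphMap he hγ]
  refine integral_congr_ae (Filter.Eventually.of_forall fun y => ?_)
  simp only [graphMap, orthogonalProjectionOnto_add_smul]
  rw [← graphDensity_mul_inner_graphNormal]
  ring

/-- A bounded piece of the graph projects into a compact subset of `eᗮ`, on which the continuous
area density is integrable. -/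
theorem measure_range_graphMap_inter_lt_top (he : ‖e‖ = 1) {γ : (perp e) → ℝ}
    (hγ : ContDiff ℝ 1 γ) {s : Set W} (hs : Bornology.IsBounded s) (hsm : MeasurableSet s) :
    μHE[Module.finrank ℝ (perp e)] (s ∩ Set.range (graphMap γ)) < ⊤ := by
  rw [← Measure.restrict_apply hsm, restrict_range_graphMap he hγ,
    (measurableEmbedding_graphMap hγ).map_apply]
  set k : Set (perp e) := closure ((perp e).orthogonalProjectionOnto '' s) with hk
  have hkc : IsCompact k := by
    refine Bornology.IsBounded.isCompact_closure ?_
    obtain ⟨C, hC⟩ := hs.exists_norm_le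
    refine isBounded_iff_forall_norm_le.2
      ⟨‖(perp e).orthogonalProjectionOnto‖ * C, ?_⟩
    rintro _ ⟨x, hx, rfl⟩
    refine (ContinuousLinearMap.le_opNorm _ _).trans ?_
    gcongr
    exact hC x hx
  have hsub : graphMap γ ⁻¹' s ⊆ k := by
    intro y hy
    refine subset_closure ⟨graphMap γ y, hy, ?_⟩
    rw [graphMap, orthogonalProjectionOnto_add_smul]
  refine (measure_mono hsub).trans_lt ?_
  rw [withDensity_apply _ hkc.measurableSet]
  exact ((continuous_graphDensity hγ).continuousOn.integrableOn_compact hkc).lintegral_lt_top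

end GraphSurface

/-! ### The outward normal at graph points -/

section Normal

variable {n : ℕ}

/-- The function `γ ∘ P - ⟪e, ·⟫` is negative exactly on the epigraph, and its gradient at the point
is `graphDensity` times `graphNormal`. Its first order expansion gives both half space conditions.
-/
theorem isOutwardUnitNormal_graphNormal {Ω : Set (EuclideanSpace ℝ (Fin n))}
    {e : EuclideanSpace ℝ (Fin n)} (he : ‖e‖ = 1) {γ : (perp e) → ℝ} (hγ : ContDiff ℝ 1 γ)
    {y : (perp e)} (h : ∀ᶠ z in 𝓝 (graphMap γ y), (z ∈ Ω ↔ z ∈ epigraph e γ)) :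
    IsOutwardUnitNormal Ω (graphMap γ y) (graphNormal γ y) := by
  refine ⟨norm_graphNormal he γ y, fun ε hε => ?_⟩
  set P := (perp e).orthogonalProjectionOnto with hP
  have hPx : P (graphMap γ y) = y := by rw [graphMap, hP, orthogonalProjectionOnto_add_smul]
  have hd : HasFDerivAt (fun z => γ (P z) - ⟪e, z⟫_ℝ)
      ((fderiv ℝ γ y).comp P - innerSL ℝ e) (graphMap γ y) := by
    have h1 : HasFDerivAt γ (fderiv ℝ γ y) (P (graphMap γ y)) := by
      rw [hPx]; exact ((hγ.differentiable (by norm_num)) y).hasFDerivAt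
    exact (h1.comp _ P.hasFDerivAt).sub (innerSL ℝ e).hasFDerivAt
  have hJ := graphDensity_pos γ y
  have hlo := hd.isLittleO.def (mul_pos hε hJ)
  filter_upwards [hlo, h] with z hz hzΩ
  have h0 : γ (P (graphMap γ y)) - ⟪e, graphMap γ y⟫_ℝ = 0 := by
    rw [hPx, graphMap, inner_add_smul_self he, sub_self]
  rw [h0, sub_zero] at hz
  simp only [sub_apply, ContinuousLinearMap.comp_apply, innerSL_apply_apply]
    at hz
  rw [← graphDensity_mul_inner_graphNormal, Real.norm_eq_abs, abs_le] at hz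
  have hmem : z ∈ Ω ↔ γ (P z) - ⟪e, z⟫_ℝ < 0 := by rw [hzΩ, sub_neg]; rfl
  rw [hmem, not_lt]
  constructor
  · intro h1
    have := mul_lt_mul_of_pos_left h1 hJ
    nlinarith [hz.1]
  · intro h1
    have := mul_lt_mul_of_pos_left h1 hJ
    nlinarith [hz.2]

theorem outwardUnitNormal_graphMap {Ω : Set (EuclideanSpace ℝ (Fin n))}
    {e : EuclideanSpace ℝ (Fin n)} (he : ‖e‖ = 1) {γ : (perp e) → ℝ} (hγ : ContDiff ℝ 1 γ)
    {y : (perp e)} (h : ∀ᶠ z in 𝓝 (graphMap γ y), (z ∈ Ω ↔ z ∈ epigraph e γ)) :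
    outwardUnitNormal Ω (graphMap γ y) = graphNormal γ y :=
  (Classical.epsilon_spec (p := IsOutwardUnitNormal Ω (graphMap γ y))
    ⟨_, isOutwardUnitNormal_graphNormal he hγ h⟩).unique (isOutwardUnitNormal_graphNormal he hγ h)

end Normal

/-! ### Partitions of unity -/

section Partition

variable {W : Type*} [NormedAddCommGroup W] [NormedSpace ℝ W] [FiniteDimensional ℝ W]

/-- Smooth partitions of unity on a compact set, subordinate to a family of balls. -/
theorem IsCompact.exists_contDiff_partition {K : Set W} (hK : IsCompact K) {r : W → ℝ}
    (hr : ∀ x ∈ K, 0 < r x) : ∃ (t : Finset W) (χ : W → W → ℝ), (∀ i ∈ t, i ∈ K) ∧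
      (∀ i, ContDiff ℝ 2 (χ i)) ∧ (∀ i ∈ t, tsupport (χ i) ⊆ Metric.ball i (r i)) ∧
      ∀ x ∈ K, ∑ i ∈ t, χ i x = 1 := by
  obtain ⟨t, htK, ht⟩ := hK.elim_nhds_subcover (fun x => Metric.ball x (r x))
    (fun x hx => Metric.ball_mem_nhds x (hr x hx))
  obtain ⟨f, hf⟩ := SmoothPartitionOfUnity.exists_isSubordinate (modelWithCornersSelf ℝ W)
    hK.isClosed (fun i : t => Metric.ball (i : W) (r i)) (fun _ => Metric.isOpen_ball)
    (by simpa [Set.iUnion_subtype] using ht)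
  classical
  refine ⟨t, fun i => if h : i ∈ t then f ⟨i, h⟩ else 0, htK, fun i => ?_, fun i hi => ?_,
    fun x hx => ?_⟩
  · by_cases h : i ∈ t
    · simp only [h, dif_pos]
      exact ((f ⟨i, h⟩).contMDiff.contDiff).of_le (WithTop.coe_le_coe.2 (le_top : (2 : ℕ∞) ≤ ⊤))
    · simp only [h, dif_neg, not_false_eq_true]
      exact contDiff_const
  · simp only [hi, dif_pos]
    exact hf ⟨i, hi⟩
  · have h := f.sum_eq_one hx
    rw [finsum_eq_sum_of_fintype] at h
    rw [← h, ← Finset.sum_coe_sort t]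
    refine Finset.sum_congr rfl fun i _ => ?_
    simp

end Partition

/-! ### Divergence theorem on bounded `C²` domains -/

section Domain

variable {n : ℕ} {Ω : Set (EuclideanSpace ℝ (Fin n))} {e x : EuclideanSpace ℝ (Fin n)} {r : ℝ}
  {γ : (perp e) → ℝ}

/-- It matches the dimension in the graph lemmas with `n - 1` in the surface measure. A unit vector
exists only for `n ≥ 1`, so the truncated subtraction loses nothing. -/
theorem finrank_perp (he : ‖e‖ = 1) : Module.finrank ℝ (perp e) = n - 1 := by
  have h := (Submodule.span ℝ {e}).finrank_add_finrank_orthogonal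
  rw [finrank_span_singleton (by rintro rfl; simp at he), finrank_euclideanSpace_fin] at h
  exact (Nat.sub_eq_of_eq_add' h.symm).symm

/-- The frontier inside an open ball depends only on the part of the set in that ball. -/
theorem frontier_inter_ball_eq (he : ‖e‖ = 1) (hγ : ContDiff ℝ 1 γ)
    (h : ∀ y ∈ Metric.ball x r, (y ∈ Ω ↔ y ∈ epigraph e γ)) :
    Metric.ball x r ∩ frontier Ω = Metric.ball x r ∩ Set.range (graphMap γ) := by
  have h1 : Ω ∩ Metric.ball x r = epigraph e γ ∩ Metric.ball x r := by
    ext y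
    exact and_congr_left fun hy => h y hy
  have h2 := frontier_epigraph he hγ.continuous
  change _ = Set.range (graphMap γ) at h2
  rw [← h2, Set.inter_comm, ← frontier_inter_open_inter Metric.isOpen_ball, h1,
    frontier_inter_open_inter Metric.isOpen_ball, Set.inter_comm]

theorem outwardUnitNormal_eq_graphNormal (he : ‖e‖ = 1) (hγ : ContDiff ℝ 1 γ)
    (h : ∀ y ∈ Metric.ball x r, (y ∈ Ω ↔ y ∈ epigraph e γ)) {z : EuclideanSpace ℝ (Fin n)}
    (hz : z ∈ Metric.ball x r ∩ frontier Ω) :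
    outwardUnitNormal Ω z = graphNormal γ ((perp e).orthogonalProjectionOnto z) := by
  have hz' := hz
  rw [frontier_inter_ball_eq he hγ h] at hz'
  obtain ⟨hzb, y, rfl⟩ := hz'
  rw [outwardUnitNormal_graphMap he hγ, graphMap, orthogonalProjectionOnto_add_smul]
  filter_upwards [Metric.isOpen_ball.mem_nhds hzb] with y hy using h y hy

theorem IsC2Domain.exists_epigraph (hΩ : IsC2Domain Ω) (hx : x ∈ frontier Ω) :
    ∃ r > (0 : ℝ), ∃ e : EuclideanSpace ℝ (Fin n), ‖e‖ = 1 ∧ ∃ γ : (perp e) → ℝ,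
      ContDiff ℝ 2 γ ∧ ∀ y ∈ Metric.ball x r, (y ∈ Ω ↔ y ∈ epigraph e γ) :=
  hΩ.exists_graph x hx

theorem continuous_graphNormal (hγ : ContDiff ℝ 1 γ) : Continuous (graphNormal γ) := by
  have h1 : Continuous fun y => (InnerProductSpace.toDual ℝ (perp e)).symm (fderiv ℝ γ y) :=
    (InnerProductSpace.toDual ℝ (perp e)).symm.continuous.comp
      (hγ.continuous_fderiv (by norm_num))
  exact ((continuous_graphDensity hγ).inv₀ fun y => (graphDensity_pos γ y).ne').smul
    ((continuous_subtype_val.comp h1).sub continuous_const)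

theorem IsC2Domain.continuousOn_outwardUnitNormal (hΩ : IsC2Domain Ω) :
    ContinuousOn (outwardUnitNormal Ω) (frontier Ω) := by
  intro x hx
  obtain ⟨r, hr, e, he, γ, hγ, h⟩ := hΩ.exists_epigraph hx
  have hγ1 := hγ.of_le (show (1 : WithTop ℕ∞) ≤ 2 by norm_num)
  have hxb := Metric.mem_ball_self (x := x) hr
  have h1 : ContinuousWithinAt
      (fun z => graphNormal γ ((perp e).orthogonalProjectionOnto z)) (frontier Ω) x :=
    ((continuous_graphNormal hγ1).comp (by fun_prop)).continuousWithinAt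
  refine h1.congr_of_eventuallyEq ?_ (outwardUnitNormal_eq_graphNormal he hγ1 h ⟨hxb, hx⟩)
  filter_upwards [self_mem_nhdsWithin,
    mem_nhdsWithin_of_mem_nhds (Metric.ball_mem_nhds x hr)] with z hz hzb
  exact outwardUnitNormal_eq_graphNormal he hγ1 h ⟨hzb, hz⟩

theorem isCompact_frontier_of_isBounded (hbd : Bornology.IsBounded Ω) : IsCompact (frontier Ω) :=
  hbd.isCompact_closure.of_isClosed_subset isClosed_frontier frontier_subset_closure

theorem IsC2Domain.measure_frontier_lt_top (hΩ : IsC2Domain Ω) (hbd : Bornology.IsBounded Ω) :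
    μHE[n - 1] (frontier Ω) < ⊤ := by
  refine (isCompact_frontier_of_isBounded hbd).measure_lt_top_of_nhdsWithin fun x hx => ?_
  obtain ⟨r, hr, e, he, γ, hγ, h⟩ := hΩ.exists_epigraph hx
  have hγ1 := hγ.of_le (show (1 : WithTop ℕ∞) ≤ 2 by norm_num)
  refine ⟨Metric.ball x r ∩ frontier Ω, Filter.inter_mem
    (mem_nhdsWithin_of_mem_nhds (Metric.ball_mem_nhds x hr)) self_mem_nhdsWithin, ?_⟩
  rw [frontier_inter_ball_eq he hγ1 h, ← finrank_perp he]
  exact measure_range_graphMap_inter_lt_top he hγ1 Metric.isBounded_ball measurableSet_ball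

theorem IsC2Domain.integrableOn_frontier (hΩ : IsC2Domain Ω) (hbd : Bornology.IsBounded Ω)
    {f : EuclideanSpace ℝ (Fin n) → ℝ} (hf : ContinuousOn f (frontier Ω)) :
    IntegrableOn f (frontier Ω) μHE[n - 1] := by
  obtain ⟨C, hC⟩ := (isCompact_frontier_of_isBounded hbd).exists_bound_of_continuousOn hf
  exact IntegrableOn.of_bound (hΩ.measure_frontier_lt_top hbd)
    (hf.aestronglyMeasurable isClosed_frontier.measurableSet) C
    ((ae_restrict_iff' isClosed_frontier.measurableSet).2 (Filter.Eventually.of_forall hC))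

theorem setIntegral_eq_of_forall_mem_iff {X : Type*} [MeasurableSpace X] {μ : Measure X}
    {s t b : Set X} (hs : MeasurableSet s) (ht : MeasurableSet t)
    (h : ∀ y ∈ b, (y ∈ s ↔ y ∈ t)) {f : X → ℝ} (hf : ∀ y ∉ b, f y = 0) :
    ∫ y in s, f y ∂μ = ∫ y in t, f y ∂μ := by
  rw [← integral_indicator hs, ← integral_indicator ht]
  congr 1
  funext y
  by_cases hy : y ∈ b
  · by_cases hys : y ∈ s
    · rw [Set.indicator_of_mem hys, Set.indicator_of_mem ((h y hy).1 hys)]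
    · rw [Set.indicator_of_notMem hys, Set.indicator_of_notMem fun h' => hys ((h y hy).2 h')]
  · simp [Set.indicator, hf y hy]

theorem hasCompactSupport_of_tsupport_subset_ball {W F : Type*} [PseudoMetricSpace W]
    [ProperSpace W] [Zero F] {φ : W → F} {x : W} {r : ℝ}
    (h : tsupport φ ⊆ Metric.ball x r) : HasCompactSupport φ :=
  (isCompact_closedBall x r).of_isClosed_subset (isClosed_tsupport _)
    (h.trans Metric.ball_subset_closedBall)

/-- Local form of the divergence theorem. Near an interior point `φ` is supported in `Ω` and both
sides vanish. Near a boundary point the support lies in a chart, where `Ω` and its frontier may be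
exchanged for an epigraph and its graph. -/
theorem IsC2Domain.exists_forall_integral_fderiv (hΩ : IsC2Domain Ω) (hx : x ∈ closure Ω) :
    ∃ r > (0 : ℝ), ∀ φ : EuclideanSpace ℝ (Fin n) → ℝ, ContDiff ℝ 1 φ →
      tsupport φ ⊆ Metric.ball x r → ∀ w, ∫ y in Ω, fderiv ℝ φ y w =
        ∫ y in frontier Ω, φ y * ⟪outwardUnitNormal Ω y, w⟫_ℝ ∂μHE[n - 1] := by
  by_cases hxΩ : x ∈ Ω
  · obtain ⟨r, hr, hrΩ⟩ := Metric.isOpen_iff.1 hΩ.isOpen x hxΩ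
    refine ⟨r, hr, fun φ hφ hs w => ?_⟩
    have hc := hasCompactSupport_of_tsupport_subset_ball hs
    rw [setIntegral_eq_integral_of_forall_compl_eq_zero,
      integral_hasFDerivAt_eq_zero (fun y => ((hφ.differentiable (by norm_num)) y).hasFDerivAt)
        (hφ.continuous_fderiv (by norm_num)) hc]
    · refine (setIntegral_eq_zero_of_forall_eq_zero fun y hy => ?_).symm
      rw [hΩ.isOpen.frontier_eq] at hy
      rw [image_eq_zero_of_notMem_tsupport fun h => hy.2 (hrΩ (hs h)), zero_mul]
    · intro y hy
      have hd : y ∉ tsupport (fderiv ℝ φ) := fun h =>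
        hy (hrΩ (hs (tsupport_fderiv_subset ℝ h)))
      rw [image_eq_zero_of_notMem_tsupport hd]
      rfl
  · have hxf : x ∈ frontier Ω := by rw [hΩ.isOpen.frontier_eq]; exact ⟨hx, hxΩ⟩
    obtain ⟨r, hr, e, he, γ, hγ, h⟩ := hΩ.exists_epigraph hxf
    have hγ1 := hγ.of_le (show (1 : WithTop ℕ∞) ≤ 2 by norm_num)
    refine ⟨r, hr, fun φ hφ hs w => ?_⟩
    have hc := hasCompactSupport_of_tsupport_subset_ball hs
    have hφ0 : ∀ y ∉ Metric.ball x r, φ y = 0 := fun y hy =>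
      image_eq_zero_of_notMem_tsupport fun h => hy (hs h)
    rw [setIntegral_eq_of_forall_mem_iff hΩ.isOpen.measurableSet
      (isOpen_epigraph hγ1.continuous).measurableSet h,
      integral_epigraph_fderiv_eq_integral_graph he hγ1 hφ hc, ← finrank_perp he]
    · have hfr := frontier_inter_ball_eq he hγ1 h
      rw [setIntegral_eq_of_forall_mem_iff (s := frontier Ω) (t := Set.range (graphMap γ))
        (b := Metric.ball x r) isClosed_frontier.measurableSet
        (measurableEmbedding_graphMap hγ1).measurableSet_range]
      · refine setIntegral_congr_fun (measurableEmbedding_graphMap hγ1).measurableSet_range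
          fun y hy => ?_
        by_cases hyb : y ∈ Metric.ball x r
        · have hy' : y ∈ Metric.ball x r ∩ frontier Ω := by rw [hfr]; exact ⟨hyb, hy⟩
          simp only [outwardUnitNormal_eq_graphNormal he hγ1 h hy']
        · simp only [hφ0 y hyb, zero_mul]
      · intro y hy
        have := Set.ext_iff.1 hfr y
        simpa only [Set.mem_inter_iff, hy, true_and] using this
      · intro y hy
        rw [hφ0 y hy, zero_mul]
    · intro y hy
      have hd : y ∉ tsupport (fderiv ℝ φ) := fun h => hy (hs (tsupport_fderiv_subset ℝ h))
      rw [image_eq_zero_of_notMem_tsupport hd]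
      rfl

theorem integrableOn_of_continuousOn_closure {f : EuclideanSpace ℝ (Fin n) → ℝ}
    (hbd : Bornology.IsBounded Ω) (hf : ContinuousOn f (closure Ω)) : IntegrableOn f Ω :=
  (hf.integrableOn_compact hbd.isCompact_closure).mono_set subset_closure

/-- **Divergence theorem** on a bounded `C²` domain. -/
theorem IsC2Domain.integral_fderiv_eq (hΩ : IsC2Domain Ω) (hbd : Bornology.IsBounded Ω)
    {φ : EuclideanSpace ℝ (Fin n) → ℝ} (hφ : ContDiff ℝ 1 φ) (w : EuclideanSpace ℝ (Fin n)) :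
    ∫ y in Ω, fderiv ℝ φ y w =
      ∫ y in frontier Ω, φ y * ⟪outwardUnitNormal Ω y, w⟫_ℝ ∂μHE[n - 1] := by
  have hloc := fun x (hx : x ∈ closure Ω) => hΩ.exists_forall_integral_fderiv hx
  choose! r hr hloc using hloc
  obtain ⟨t, χ, htK, hχ, hsupp, hsum⟩ := hbd.isCompact_closure.exists_contDiff_partition hr
  have hχ1 : ∀ i, ContDiff ℝ 1 (fun x => χ i x * φ x) := fun i =>
    ((hχ i).of_le (by norm_num)).mul hφ
  -- Differentiating the decomposition needs `∑ χᵢ = 1` on a neighbourhood of `y`, which openness of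
  -- `Ω` supplies. The boundary integral only needs it pointwise.
  have h1 : ∫ y in Ω, fderiv ℝ φ y w =
      ∫ y in Ω, ∑ i ∈ t, fderiv ℝ (fun x => χ i x * φ x) y w := by
    refine setIntegral_congr_fun hΩ.isOpen.measurableSet fun y hy => ?_
    have heq : φ =ᶠ[𝓝 y] fun x => ∑ i ∈ t, χ i x * φ x := by
      filter_upwards [hΩ.isOpen.mem_nhds hy] with z hz
      rw [← Finset.sum_mul, hsum z (subset_closure hz), one_mul]
    beta_reduce
    rw [heq.fderiv_eq, fderiv_fun_sum fun i _ => ((hχ1 i).differentiable (by norm_num)) y,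
      sum_apply]
  have h2 : ∫ y in frontier Ω, φ y * ⟪outwardUnitNormal Ω y, w⟫_ℝ ∂μHE[n - 1] =
      ∫ y in frontier Ω, ∑ i ∈ t, (χ i y * φ y) * ⟪outwardUnitNormal Ω y, w⟫_ℝ ∂μHE[n - 1] := by
    refine setIntegral_congr_fun isClosed_frontier.measurableSet fun y hy => ?_
    rw [← Finset.sum_mul, ← Finset.sum_mul, hsum y (frontier_subset_closure hy), one_mul]
  rw [h1, h2, integral_finsetSum, integral_finsetSum]
  · refine Finset.sum_congr rfl fun i hi => hloc i (htK i hi) _ (hχ1 i) ?_ w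
    exact (tsupport_mul_subset_left (f := χ i) (g := φ)).trans (hsupp i hi)
  · intro i _
    refine hΩ.integrableOn_frontier hbd ?_
    exact (hχ1 i).continuous.continuousOn.mul
      (hΩ.continuousOn_outwardUnitNormal.inner (𝕜 := ℝ) continuousOn_const)
  · intro i _
    refine integrableOn_of_continuousOn_closure hbd ?_
    exact (((hχ1 i).continuous_fderiv (by norm_num)).clm_apply continuous_const).continuousOn

end Domain

/-! ### Cutoff, shift and mollification -/

/-- `u` is `C¹` in the open set `S`, and `u` and its derivative `u'` are continuous on the closure
of `S`. -/
structure IsC1ExtOn {W F : Type*} [NormedAddCommGroup W] [NormedSpace ℝ W] [NormedAddCommGroup F]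
    [NormedSpace ℝ F] (S : Set W) (u : W → F) (u' : W → W →L[ℝ] F) : Prop where
  continuousOn : ContinuousOn u (closure S)
  continuousOn' : ContinuousOn u' (closure S)
  hasFDerivAt : ∀ x ∈ S, HasFDerivAt u (u' x) x

section Approximation

variable {W F : Type*} [NormedAddCommGroup W] [NormedAddCommGroup F]

/-- Uniform continuity on a possibly unbounded closed set. If one of two points at distance at most
`1` lies in `K`, both lie in the compact `1`-thickening of `K`; otherwise both values are zero. -/
theorem exists_pos_forall_dist_le_of_isCompact_support {S K : Set W} [ProperSpace W]
    (hS : IsClosed S) (hK : IsCompact K) {v : W → F} (hv : ContinuousOn v S)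
    (hvK : ∀ x ∉ K, v x = 0) {ε : ℝ} (hε : 0 < ε) :
    ∃ δ > 0, ∀ x ∈ S, ∀ y ∈ S, dist x y ≤ δ → dist (v x) (v y) ≤ ε := by
  have hC : IsCompact (S ∩ Metric.cthickening 1 K) := hK.cthickening.inter_left hS
  obtain ⟨δ, hδ, h⟩ := Metric.uniformContinuousOn_iff_le.1
    (hC.uniformContinuousOn_of_continuous (hv.mono Set.inter_subset_left)) ε hε
  refine ⟨min δ 1, by positivity, fun x hx y hy hxy => ?_⟩
  by_cases hK' : x ∈ K ∨ y ∈ K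
  · refine h x ⟨hx, ?_⟩ y ⟨hy, ?_⟩ (hxy.trans (min_le_left _ _))
    · rcases hK' with h1 | h1
      · exact Metric.self_subset_cthickening K h1
      · exact Metric.mem_cthickening_of_dist_le x y 1 K h1 (hxy.trans (min_le_right _ _))
    · rcases hK' with h1 | h1
      · rw [dist_comm] at hxy
        exact Metric.mem_cthickening_of_dist_le y x 1 K h1 (hxy.trans (min_le_right _ _))
      · exact Metric.self_subset_cthickening K h1
  · rw [not_or] at hK'
    rw [hvK x hK'.1, hvK y hK'.2, dist_self]
    exact hε.le

variable [NormedSpace ℝ F]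

theorem IsC1ExtOn.contDiffOn [NormedSpace ℝ W] {S : Set W} (hS : IsOpen S) {u : W → F}
    {u' : W → W →L[ℝ] F} (h : IsC1ExtOn S u u') : ContDiffOn ℝ 1 u S := by
  rw [show (1 : WithTop ℕ∞) = 0 + 1 by norm_num, contDiffOn_succ_iff_fderiv_of_isOpen hS]
  refine ⟨fun x hx => (h.hasFDerivAt x hx).differentiableAt.differentiableWithinAt,
    by simp, ?_⟩
  rw [contDiffOn_zero]
  exact (h.continuousOn'.mono subset_closure).congr fun x hx => (h.hasFDerivAt x hx).fderiv

/-- Mollification: compactly supported `C¹` functions are `C¹`-limits of smooth functions. -/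
theorem exists_contDiff_forall_dist_le [NormedSpace ℝ W] [FiniteDimensional ℝ W]
    [CompleteSpace F] {f : W → F}
    (hf : ContDiff ℝ 1 f) (hc : HasCompactSupport f) {ε : ℝ} (hε : 0 < ε) :
    ∃ g : W → F, ContDiff ℝ 2 g ∧
      ∀ x, dist (g x) (f x) ≤ ε ∧ dist (fderiv ℝ g x) (fderiv ℝ f x) ≤ ε := by
  borelize W
  let μ : Measure W := Measure.addHaar
  have hf' : Continuous (fderiv ℝ f) := hf.continuous_fderiv (by norm_num)
  obtain ⟨δ₁, hδ₁, h1⟩ := Metric.uniformContinuous_iff.1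
    (hc.uniformContinuous_of_continuous hf.continuous) ε hε
  obtain ⟨δ₂, hδ₂, h2⟩ := Metric.uniformContinuous_iff.1
    ((hc.fderiv ℝ).uniformContinuous_of_continuous hf') ε hε
  have hδ : 0 < min δ₁ δ₂ := lt_min hδ₁ hδ₂
  -- One radius works for `f` and for its derivative, because the derivative of the mollification is
  -- the mollification of the derivative.
  let φ : ContDiffBump (0 : W) := ⟨min δ₁ δ₂ / 2, min δ₁ δ₂, by positivity, by linarith⟩
  have hφc : Continuous (φ.normed μ) := φ.continuous_normed
  refine ⟨convolution (φ.normed μ) f (ContinuousLinearMap.lsmul ℝ ℝ) μ, ?_, fun x => ⟨?_, ?_⟩⟩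
  · exact φ.hasCompactSupport_normed.contDiff_convolution_left (n := 2) _ φ.contDiff_normed
      hf.continuous.locallyIntegrable
  · exact φ.dist_normed_convolution_le hf.continuous.aestronglyMeasurable fun y hy =>
      (h1 (hy.trans_le (min_le_left _ _))).le
  · rw [(hc.hasFDerivAt_convolution_right (μ := μ) (ContinuousLinearMap.lsmul ℝ ℝ)
      (hφc.locallyIntegrable) hf x).fderiv]
    have : convolution (φ.normed μ) (fderiv ℝ f)
        ((ContinuousLinearMap.lsmul ℝ ℝ : ℝ →L[ℝ] F →L[ℝ] F).precompR W) μ x =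
        convolution (φ.normed μ) (fderiv ℝ f) (ContinuousLinearMap.lsmul ℝ ℝ) μ x := by
      refine integral_congr_ae (Filter.Eventually.of_forall fun t => ?_)
      ext w
      simp [ContinuousLinearMap.precompR_apply]
    rw [this]
    exact φ.dist_normed_convolution_le hf'.aestronglyMeasurable fun y hy =>
      (h2 (hy.trans_le (min_le_right _ _))).le

/-- Multiplication with a cutoff function supported in a ball where `Ω` and `S` agree. -/
theorem IsC1ExtOn.cutoff [NormedSpace ℝ W] {Ω S : Set W} {u : W → F} {u' : W → W →L[ℝ] F}
    (h : IsC1ExtOn Ω u u') {x : W} {r : ℝ} (hS : ∀ y ∈ Metric.ball x r, (y ∈ Ω ↔ y ∈ S))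
    {χ : W → ℝ} (hχ : ContDiff ℝ 1 χ) (hsupp : tsupport χ ⊆ Metric.ball x r) :
    IsC1ExtOn S (fun y => χ y • u y)
      (fun y => χ y • u' y + (fderiv ℝ χ y).smulRight (u y)) := by
  have hχ' : Continuous (fderiv ℝ χ) := hχ.continuous_fderiv (by norm_num)
  -- Off the support of `χ` the product vanishes locally, so nothing is required of `u` where `S`
  -- and `Ω` may differ.
  have hzero : ∀ y ∉ tsupport χ, ∀ᶠ z in 𝓝 y, χ z = 0 ∧ fderiv ℝ χ z = 0 := by
    intro y hy
    filter_upwards [(isClosed_tsupport χ).isOpen_compl.mem_nhds hy] with z hz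
    exact ⟨image_eq_zero_of_notMem_tsupport hz,
      image_eq_zero_of_notMem_tsupport fun h' => hz (tsupport_fderiv_subset ℝ h')⟩
  have hcl : ∀ y ∈ closure S, y ∈ Metric.ball x r →
      y ∈ closure Ω ∧ closure Ω ∈ 𝓝[closure S] y := by
    have hsub : closure S ∩ Metric.ball x r ⊆ closure Ω := by
      rintro y ⟨hy, hyb⟩
      have h1 : y ∈ closure (S ∩ Metric.ball x r) :=
        Metric.isOpen_ball.closure_inter ⟨hy, hyb⟩
      exact closure_mono (fun z hz => (hS z hz.2).2 hz.1) h1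
    intro y hy hyb
    refine ⟨hsub ⟨hy, hyb⟩, Filter.mem_of_superset ?_ hsub⟩
    exact Filter.inter_mem self_mem_nhdsWithin
      (mem_nhdsWithin_of_mem_nhds (Metric.isOpen_ball.mem_nhds hyb))
  refine ⟨fun y hy => ?_, fun y hy => ?_, fun y hy => ?_⟩
  · by_cases hyt : y ∈ tsupport χ
    · obtain ⟨h1, h2⟩ := hcl y hy (hsupp hyt)
      exact hχ.continuous.continuousWithinAt.smul ((h.continuousOn y h1).mono_of_mem_nhdsWithin h2)
    · refine (continuousWithinAt_const (b := (0 : F))).congr_of_eventuallyEq ?_ ?_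
      · filter_upwards [mem_nhdsWithin_of_mem_nhds (hzero y hyt)] with z hz
        rw [hz.1, zero_smul]
      · rw [(hzero y hyt).self_of_nhds.1, zero_smul]
  · by_cases hyt : y ∈ tsupport χ
    · obtain ⟨h1, h2⟩ := hcl y hy (hsupp hyt)
      refine (hχ.continuous.continuousWithinAt.smul
        ((h.continuousOn' y h1).mono_of_mem_nhdsWithin h2)).add ?_
      have hsm : Continuous fun p : (W →L[ℝ] ℝ) × F => p.1.smulRight p.2 :=
        (ContinuousLinearMap.smulRightL ℝ W F).continuous₂
      exact hsm.continuousAt.comp_continuousWithinAt (f := fun z => (fderiv ℝ χ z, u z))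
        (hχ'.continuousWithinAt.prodMk ((h.continuousOn y h1).mono_of_mem_nhdsWithin h2))
    · refine (continuousWithinAt_const (b := (0 : W →L[ℝ] F))).congr_of_eventuallyEq ?_ ?_
      · filter_upwards [mem_nhdsWithin_of_mem_nhds (hzero y hyt)] with z hz
        rw [hz.1, hz.2]
        ext; simp
      · rw [(hzero y hyt).self_of_nhds.1, (hzero y hyt).self_of_nhds.2]
        ext; simp
  · by_cases hyt : y ∈ tsupport χ
    · exact ((hχ.differentiable (by norm_num)) y).hasFDerivAt.smul
        (h.hasFDerivAt y ((hS y (hsupp hyt)).2 hy))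
    · have h1 : (fun z => χ z • u z) =ᶠ[𝓝 y] fun _ => 0 := by
        filter_upwards [hzero y hyt] with z hz
        rw [hz.1, zero_smul]
      rw [(hzero y hyt).self_of_nhds.1, (hzero y hyt).self_of_nhds.2]
      refine HasFDerivAt.congr_of_eventuallyEq ?_ h1
      convert hasFDerivAt_const (0 : F) y using 1
      ext; simp

variable [InnerProductSpace ℝ W] [FiniteDimensional ℝ W] [CompleteSpace F]

/-- Functions of compact support which are `C¹` up to the boundary of the region above a graph are
approximated by smooth functions, by shifting upwards and mollifying. -/
theorem IsC1ExtOn.exists_contDiff_epigraph {e : W} (he : ‖e‖ = 1) {γ : (perp e) → ℝ}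
    (hγ : ContDiff ℝ 1 γ) {v : W → F} {v' : W → W →L[ℝ] F} (h : IsC1ExtOn (epigraph e γ) v v')
    {K : Set W} (hK : IsCompact K) (hv : ∀ x ∉ K, v x = 0) (hv' : ∀ x ∉ K, v' x = 0)
    {O : Set W} (hO : IsOpen O) (hKO : K ⊆ O) {ε : ℝ} (hε : 0 < ε) :
    ∃ g : W → F, ContDiff ℝ 2 g ∧
      (∀ x ∈ closure (epigraph e γ), dist (g x) (v x) ≤ ε ∧ dist (fderiv ℝ g x) (v' x) ≤ ε) ∧
      ∀ x ∉ O, dist (g x) 0 ≤ ε ∧ dist (fderiv ℝ g x) 0 ≤ ε := by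
  have hε2 : 0 < ε / 2 := half_pos hε
  obtain ⟨δ₁, hδ₁, h1⟩ :=
    exists_pos_forall_dist_le_of_isCompact_support isClosed_closure hK h.continuousOn hv hε2
  obtain ⟨δ₂, hδ₂, h2⟩ :=
    exists_pos_forall_dist_le_of_isCompact_support isClosed_closure hK h.continuousOn' hv' hε2
  obtain ⟨δ₃, hδ₃, h3⟩ := hK.exists_cthickening_subset_open hO hKO
  -- Shifting by `δ` changes `v` and `v'` on the closed epigraph by at most `ε / 2`. The choice of
  -- `δ₃` keeps the shifted support of `v` inside `O`.
  set δ := min (min δ₁ δ₂) δ₃ with hδdef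
  have hδ : 0 < δ := lt_min (lt_min hδ₁ hδ₂) hδ₃
  have hle₁ : δ ≤ δ₁ := (min_le_left _ _).trans (min_le_left _ _)
  have hle₂ : δ ≤ δ₂ := (min_le_left _ _).trans (min_le_right _ _)
  set s : W → ℝ := fun x => ⟪e, x⟫_ℝ - γ ((perp e).orthogonalProjectionOnto x) with hs
  have hsC : ContDiff ℝ 1 s := (contDiff_const.inner ℝ contDiff_id).sub
    (hγ.comp (perp e).orthogonalProjectionOnto.contDiff)
  have hshift : ∀ x, s (x + δ • e) = s x + δ := by
    intro x
    have hPe : (perp e).orthogonalProjectionOnto e = 0 := by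
      simpa only [Submodule.coe_zero, zero_add, one_smul] using
        orthogonalProjectionOnto_add_smul (0 : perp e) (1 : ℝ)
    simp only [hs, map_add, map_smul, hPe, smul_zero, add_zero, inner_add_right, inner_smul_right,
      real_inner_self_eq_norm_sq, he]
    ring
  have hmem : ∀ x, x ∈ epigraph e γ ↔ 0 < s x := fun x => by rw [hs, sub_pos]; rfl
  have hmemc : ∀ x, x ∈ closure (epigraph e γ) ↔ 0 ≤ s x :=
    fun x => mem_closure_epigraph_iff he hγ.continuous
  -- The shifted function is `C¹` only where the height `s` over the graph exceeds `-δ`. This cutoff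
  -- is `0` for `s ≤ -δ/2` and `1` for `s ≥ -δ/4`, so the product is `C¹` everywhere and unchanged
  -- near the closed epigraph.
  set τ : W → ℝ := fun x => Real.smoothTransition (2 + 4 / δ * s x) with hτ
  have hτC : ContDiff ℝ 1 τ :=
    (Real.smoothTransition.contDiff (n := 1)).comp (contDiff_const.add (contDiff_const.mul hsC))
  set f : W → F := fun x => τ x • v (x + δ • e) with hf
  have hfC : ContDiff ℝ 1 f := by
    rw [contDiff_iff_contDiffAt]
    intro x
    rcases lt_or_ge (-δ) (s x) with hx | hx
    · refine hτC.contDiffAt.smul ?_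
      have h3 : ContDiffAt ℝ 1 v (x + δ • e) := by
        refine (h.contDiffOn (isOpen_epigraph hγ.continuous)).contDiffAt
          ((isOpen_epigraph hγ.continuous).mem_nhds ?_)
        rw [hmem, hshift]
        linarith
      exact h3.comp x (contDiffAt_id.add contDiffAt_const)
    · have h3 : f =ᶠ[𝓝 x] fun _ => 0 := by
        have : ∀ᶠ y in 𝓝 x, s y < -δ / 2 :=
          hsC.continuous.continuousAt.eventually_lt_const (by linarith)
        filter_upwards [this] with y hy
        have h4 : 2 + 4 / δ * s y ≤ 0 := by
          have : 4 / δ * s y ≤ 4 / δ * (-δ / 2) := by gcongr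
          have h5 : 4 / δ * (-δ / 2) = -2 := by field_simp; norm_num
          linarith
        simp only [hf, hτ, Real.smoothTransition.zero_of_nonpos h4, zero_smul]
      exact contDiffAt_const.congr_of_eventuallyEq h3
  have hfc : HasCompactSupport f := by
    refine HasCompactSupport.intro (hK.image (continuous_sub_right (δ • e))) fun x hx => ?_
    have : x + δ • e ∉ K := fun hxK => hx ⟨x + δ • e, hxK, by simp⟩
    simp only [hf, hv _ this, smul_zero]
  have hnear : ∀ x ∈ closure (epigraph e γ), f =ᶠ[𝓝 x] fun y => v (y + δ • e) := by
    intro x hx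
    rw [hmemc] at hx
    have : ∀ᶠ y in 𝓝 x, -δ / 4 < s y :=
      hsC.continuous.continuousAt.eventually_const_lt (by linarith)
    filter_upwards [this] with y hy
    have h4 : 1 ≤ 2 + 4 / δ * s y := by
      have : 4 / δ * (-δ / 4) ≤ 4 / δ * s y := by gcongr
      have h5 : 4 / δ * (-δ / 4) = -1 := by field_simp
      linarith
    simp only [hf, hτ, Real.smoothTransition.one_of_one_le h4, one_smul]
  obtain ⟨g, hg, hgf⟩ := exists_contDiff_forall_dist_le hfC hfc hε2
  have hd : ∀ x, dist (x + δ • e) x ≤ δ := fun x => by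
    rw [dist_eq_norm, add_sub_cancel_left, norm_smul, he, mul_one, Real.norm_of_nonneg hδ.le]
  refine ⟨g, hg, fun x hx => ?_, fun x hx => ?_⟩
  swap
  · have hxK : x + δ • e ∉ K := fun hxK => hx (h3 (Metric.mem_cthickening_of_dist_le x _ _ _ hxK
      (by rw [dist_comm]; exact (hd x).trans (min_le_right _ _))))
    have hfx : f =ᶠ[𝓝 x] fun _ => 0 := by
      have hcont : Continuous fun y : W => y + δ • e := by fun_prop
      filter_upwards [hcont.continuousAt.preimage_mem_nhds
        (hK.isClosed.isOpen_compl.mem_nhds hxK)] with y hy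
      simp only [hf, hv _ hy, smul_zero]
    obtain ⟨h4, h5⟩ := hgf x
    rw [hfx.eq_of_nhds] at h4
    rw [hfx.fderiv_eq, fderiv_const_apply] at h5
    exact ⟨h4.trans (by linarith), h5.trans (by linarith)⟩
  have hx' : x + δ • e ∈ epigraph e γ := by
    rw [hmem, hshift]
    have := (hmemc x).1 hx
    linarith
  have hfd : fderiv ℝ f x = v' (x + δ • e) := by
    rw [(hnear x hx).fderiv_eq, fderiv_comp_add_right, (h.hasFDerivAt _ hx').fderiv]
  obtain ⟨h3, h4⟩ := hgf x
  rw [(hnear x hx).eq_of_nhds] at h3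
  rw [hfd] at h4
  have h5 := h1 _ (subset_closure hx') x hx ((hd x).trans hle₁)
  have h6 := h2 _ (subset_closure hx') x hx ((hd x).trans hle₂)
  exact ⟨(dist_triangle _ _ _).trans (by linarith), (dist_triangle _ _ _).trans (by linarith)⟩

theorem IsC1ExtOn.exists_contDiff_univ {v : W → F} {v' : W → W →L[ℝ] F}
    (h : IsC1ExtOn Set.univ v v') (hc : HasCompactSupport v) {ε : ℝ} (hε : 0 < ε) :
    ∃ g : W → F, ContDiff ℝ 2 g ∧
      ∀ x, dist (g x) (v x) ≤ ε ∧ dist (fderiv ℝ g x) (v' x) ≤ ε := by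
  obtain ⟨g, hg, hgv⟩ := exists_contDiff_forall_dist_le
    (contDiffOn_univ.1 (h.contDiffOn isOpen_univ)) hc hε
  refine ⟨g, hg, fun x => ?_⟩
  rw [← (h.hasFDerivAt x trivial).fderiv]
  exact hgv x

end Approximation

/-! ### `C²` functions are dense in `C¹` up to the boundary -/

section Density

variable {n : ℕ} {Ω : Set (EuclideanSpace ℝ (Fin n))} {F : Type*} [NormedAddCommGroup F]
  [NormedSpace ℝ F] [CompleteSpace F]

/-- Near a boundary point the cut-off function is transplanted to the epigraph and approximated
there. Beyond the chart `Ω` may leave the epigraph; there the smallness of `g` and its derivative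
outside the ball is used instead. -/
theorem IsC2Domain.exists_forall_exists_contDiff (hΩ : IsC2Domain Ω)
    {u : EuclideanSpace ℝ (Fin n) → F} {u' : EuclideanSpace ℝ (Fin n) →
      EuclideanSpace ℝ (Fin n) →L[ℝ] F} (h : IsC1ExtOn Ω u u')
    {x : EuclideanSpace ℝ (Fin n)} (hx : x ∈ closure Ω) :
    ∃ r > (0 : ℝ), ∀ χ : EuclideanSpace ℝ (Fin n) → ℝ, ContDiff ℝ 1 χ →
      tsupport χ ⊆ Metric.ball x r → ∀ ε > 0, ∃ g : EuclideanSpace ℝ (Fin n) → F,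
        ContDiff ℝ 2 g ∧ ∀ y ∈ Ω, dist (g y) (χ y • u y) ≤ ε ∧
          dist (fderiv ℝ g y) (χ y • u' y + (fderiv ℝ χ y).smulRight (u y)) ≤ ε := by
  by_cases hxΩ : x ∈ Ω
  · obtain ⟨r, hr, hrΩ⟩ := Metric.isOpen_iff.1 hΩ.isOpen x hxΩ
    refine ⟨r, hr, fun χ hχ hs ε hε => ?_⟩
    have h1 := h.cutoff (S := Set.univ) (fun y hy => by simpa using hrΩ hy) hχ hs
    obtain ⟨g, hg, hgu⟩ := h1.exists_contDiff_univ
      ((hasCompactSupport_of_tsupport_subset_ball hs).smul_right) hε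
    exact ⟨g, hg, fun y _ => hgu y⟩
  · have hxf : x ∈ frontier Ω := by rw [hΩ.isOpen.frontier_eq]; exact ⟨hx, hxΩ⟩
    obtain ⟨r, hr, e, he, γ, hγ, hchart⟩ := hΩ.exists_epigraph hxf
    have hγ1 := hγ.of_le (show (1 : WithTop ℕ∞) ≤ 2 by norm_num)
    refine ⟨r, hr, fun χ hχ hs ε hε => ?_⟩
    have h0 : ∀ y ∉ tsupport χ, χ y = 0 ∧ fderiv ℝ χ y = 0 := fun y hy =>
      ⟨image_eq_zero_of_notMem_tsupport hy,
        image_eq_zero_of_notMem_tsupport fun h' => hy (tsupport_fderiv_subset ℝ h')⟩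
    obtain ⟨g, hg, hgu, hgO⟩ := (h.cutoff hchart hχ hs).exists_contDiff_epigraph he hγ1
      (hasCompactSupport_of_tsupport_subset_ball hs)
      (fun y hy => by rw [(h0 y hy).1, zero_smul])
      (fun y hy => by rw [(h0 y hy).1, (h0 y hy).2]; ext; simp) Metric.isOpen_ball hs hε
    refine ⟨g, hg, fun y hy => ?_⟩
    by_cases hyb : y ∈ Metric.ball x r
    · exact hgu y (subset_closure ((hchart y hyb).1 hy))
    · have hyt : y ∉ tsupport χ := fun h' => hyb (hs h')
      have h2 := hgO y hyb
      rw [(h0 y hyt).1, (h0 y hyt).2, zero_smul, zero_smul, zero_add]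
      convert h2 using 3
      ext; simp

/-- Functions which are `C¹` up to the boundary of a bounded `C²` domain are approximated, together
with their derivatives, uniformly on the closure, by functions which are `C²` on the whole space. -/
theorem IsC2Domain.exists_contDiff_approx (hΩ : IsC2Domain Ω) (hbd : Bornology.IsBounded Ω)
    {u : EuclideanSpace ℝ (Fin n) → F} {u' : EuclideanSpace ℝ (Fin n) →
      EuclideanSpace ℝ (Fin n) →L[ℝ] F} (h : IsC1ExtOn Ω u u') {ε : ℝ} (hε : 0 < ε) :
    ∃ g : EuclideanSpace ℝ (Fin n) → F, ContDiff ℝ 2 g ∧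
      ∀ x ∈ closure Ω, dist (g x) (u x) ≤ ε ∧ dist (fderiv ℝ g x) (u' x) ≤ ε := by
  have hloc := fun x (hx : x ∈ closure Ω) => hΩ.exists_forall_exists_contDiff h hx
  choose! r hr hloc using hloc
  obtain ⟨t, χ, htK, hχ, hsupp, hsum⟩ := hbd.isCompact_closure.exists_contDiff_partition hr
  have hχ1 : ∀ i, ContDiff ℝ 1 (χ i) := fun i => (hχ i).of_le (by norm_num)
  -- The errors of the `t.card` pieces then add up to at most `ε`; the `+ 1` avoids a zero
  -- denominator when `t` is empty.
  set η : ℝ := ε / (t.card + 1) with hη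
  have hη0 : 0 < η := by positivity
  have hηε : t.card • η ≤ ε := by
    rw [nsmul_eq_mul, hη, ← mul_div_assoc, div_le_iff₀ (by positivity)]
    nlinarith
  have hex : ∀ i, ∃ g : EuclideanSpace ℝ (Fin n) → F, ContDiff ℝ 2 g ∧ (i ∈ t → ∀ y ∈ Ω,
      dist (g y) (χ i y • u y) ≤ η ∧
        dist (fderiv ℝ g y) (χ i y • u' y + (fderiv ℝ (χ i) y).smulRight (u y)) ≤ η) := by
    intro i
    by_cases hi : i ∈ t
    · obtain ⟨g, hg, hgu⟩ := hloc i (htK i hi) (χ i) (hχ1 i) (hsupp i hi) η hη0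
      exact ⟨g, hg, fun _ => hgu⟩
    · exact ⟨0, contDiff_const, fun h' => absurd h' hi⟩
  choose g hg hgu using hex
  have hG : ContDiff ℝ 2 fun y => ∑ i ∈ t, g i y := ContDiff.sum fun i _ => hg i
  refine ⟨fun y => ∑ i ∈ t, g i y, hG, ?_⟩
  have hin : ∀ x ∈ Ω, dist (∑ i ∈ t, g i x) (u x) ≤ ε ∧
      dist (fderiv ℝ (fun y => ∑ i ∈ t, g i y) x) (u' x) ≤ ε := by
    intro x hx
    constructor
    · have h1 : u x = ∑ i ∈ t, χ i x • u x := by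
        rw [← Finset.sum_smul, hsum x (subset_closure hx), one_smul]
      rw [h1]
      exact (dist_sum_sum_le_of_le t fun i hi => (hgu i hi x hx).1).trans (by simpa using hηε)
    -- The derivatives of the cutoffs sum to zero, so the terms `dχᵢ · u` of the product rule
    -- disappear in the sum.
    · have hdχ : ∑ i ∈ t, fderiv ℝ (χ i) x = 0 := by
        rw [← fderiv_fun_sum fun i _ => ((hχ1 i).differentiable (by norm_num)) x]
        have : (fun y => ∑ i ∈ t, χ i y) =ᶠ[𝓝 x] fun _ => 1 := by
          filter_upwards [hΩ.isOpen.mem_nhds hx] with y hy using hsum y (subset_closure hy)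
        rw [this.fderiv_eq, fderiv_const_apply]
      have h1 : u' x = ∑ i ∈ t, (χ i x • u' x + (fderiv ℝ (χ i) x).smulRight (u x)) := by
        rw [Finset.sum_add_distrib, ← Finset.sum_smul, hsum x (subset_closure hx), one_smul]
        have h2 : ∑ i ∈ t, (fderiv ℝ (χ i) x).smulRight (u x) = 0 := by
          ext w
          have := congrArg (fun L : EuclideanSpace ℝ (Fin n) →L[ℝ] ℝ => L w) hdχ
          simp only [sum_apply, zero_apply] at this
          simp [sum_apply, ← Finset.sum_smul, this]
        rw [h2, add_zero]
      rw [h1, fderiv_fun_sum fun i _ => ((hg i).differentiable (by norm_num)) x]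
      exact (dist_sum_sum_le_of_le t fun i hi => (hgu i hi x hx).2).trans (by simpa using hηε)
  have hG' : Continuous (fderiv ℝ fun y => ∑ i ∈ t, g i y) := hG.continuous_fderiv (by norm_num)
  intro x hx
  -- The estimates hold on `Ω` and pass to the closure by continuity of `u` and `u'` there.
  exact ⟨le_on_closure (fun y hy => (hin y hy).1)
      (continuous_dist.comp_continuousOn (hG.continuous.continuousOn.prodMk h.continuousOn)) continuousOn_const hx,
    le_on_closure (fun y hy => (hin y hy).2)
      (continuous_dist.comp_continuousOn (hG'.continuousOn.prodMk h.continuousOn')) continuousOn_const hx⟩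

end Density

/-! ### The null Lagrangian as a boundary integral -/

section NullLagrangian

variable {n : ℕ} {Ω : Set (EuclideanSpace ℝ (Fin n))} {F : Type*} [NormedAddCommGroup F]
  [NormedSpace ℝ F]

/-- The integrand is `∂_a(b(w, ∂_c w)) - ∂_c(b(w, ∂_a w))`: the two terms with second derivatives
agree by symmetry of `D²w`. No symmetry of `b` is needed. -/
theorem IsC2Domain.integral_antisymm_of_contDiff (hΩ : IsC2Domain Ω)
    (hbd : Bornology.IsBounded Ω) (b : F →L[ℝ] F →L[ℝ] ℝ) {w : EuclideanSpace ℝ (Fin n) → F}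
    (hw : ContDiff ℝ 2 w) (a c : EuclideanSpace ℝ (Fin n)) :
    ∫ x in Ω, (b (fderiv ℝ w x a) (fderiv ℝ w x c) - b (fderiv ℝ w x c) (fderiv ℝ w x a)) =
      ∫ x in frontier Ω, (⟪outwardUnitNormal Ω x, a⟫_ℝ * b (w x) (fderiv ℝ w x c) -
        ⟪outwardUnitNormal Ω x, c⟫_ℝ * b (w x) (fderiv ℝ w x a)) ∂μHE[n - 1] := by
  have hw1 : ContDiff ℝ 1 w := hw.of_le (by norm_num)
  have hw' : ContDiff ℝ 1 (fderiv ℝ w) := hw.fderiv_right (by norm_num)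
  have hdir : ∀ v, ContDiff ℝ 1 fun x => fderiv ℝ w x v := fun v => hw'.clm_apply contDiff_const
  have hφ : ∀ v, ContDiff ℝ 1 fun x => b (w x) (fderiv ℝ w x v) := fun v =>
    (b.contDiff.comp hw1).clm_apply (hdir v)
  have hder : ∀ x v v', fderiv ℝ (fun x => b (w x) (fderiv ℝ w x v)) x v' =
      b (fderiv ℝ w x v') (fderiv ℝ w x v) + b (w x) (fderiv ℝ (fderiv ℝ w) x v' v) := by
    intro x v v'
    have h1 := ((hw1.differentiable (by norm_num)) x).hasFDerivAt
    have h2 : HasFDerivAt (fun x => fderiv ℝ w x v)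
        ((fderiv ℝ (fderiv ℝ w) x).flip v) x := by
      simpa using ((hw'.differentiable (by norm_num)) x).hasFDerivAt.clm_apply
        (hasFDerivAt_const v x)
    rw [(b.hasFDerivAt_of_bilinear h1 h2).fderiv]
    simp [add_comm]
  have hsymm : ∀ x, fderiv ℝ (fderiv ℝ w) x a c = fderiv ℝ (fderiv ℝ w) x c a := fun x =>
    (hw.contDiffAt.isSymmSndFDerivAt (by simp)).eq a c
  have hint : ∀ v v', IntegrableOn
      (fun x => fderiv ℝ (fun x => b (w x) (fderiv ℝ w x v)) x v') Ω := fun v v' =>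
    integrableOn_of_continuousOn_closure hbd
      (((hφ v).continuous_fderiv (by norm_num)).clm_apply continuous_const).continuousOn
  have hintf : ∀ v v', IntegrableOn
      (fun x => b (w x) (fderiv ℝ w x v) * ⟪outwardUnitNormal Ω x, v'⟫_ℝ)
      (frontier Ω) μHE[n - 1] := fun v v' =>
    hΩ.integrableOn_frontier hbd ((hφ v).continuous.continuousOn.mul
      (hΩ.continuousOn_outwardUnitNormal.inner (𝕜 := ℝ) continuousOn_const))
  calc _ = ∫ x in Ω, (fderiv ℝ (fun x => b (w x) (fderiv ℝ w x c)) x a -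
        fderiv ℝ (fun x => b (w x) (fderiv ℝ w x a)) x c) := by
        congr 1
        funext x
        rw [hder, hder, hsymm]
        ring
    _ = _ := by
        rw [integral_sub (hint c a) (hint a c), hΩ.integral_fderiv_eq hbd (hφ c),
          hΩ.integral_fderiv_eq hbd (hφ a), ← integral_sub (hintf c a) (hintf a c)]
        congr 1
        funext x
        ring

/-- Integrals of functions bounded on a set of finite measure pass to pointwise limits. -/
theorem tendsto_setIntegral_of_bounded {X : Type*} [MeasurableSpace X] {μ : Measure X} {s : Set X}
    (hs : MeasurableSet s) (hμ : μ s < ⊤) {f : ℕ → X → ℝ} {g : X → ℝ} (C : ℝ)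
    (hf : ∀ k, AEStronglyMeasurable (f k) (μ.restrict s)) (hC : ∀ k, ∀ x ∈ s, |f k x| ≤ C)
    (hlim : ∀ x ∈ s, Filter.Tendsto (fun k => f k x) Filter.atTop (𝓝 (g x))) :
    Filter.Tendsto (fun k => ∫ x in s, f k x ∂μ) Filter.atTop (𝓝 (∫ x in s, g x ∂μ)) := by
  refine tendsto_integral_of_dominated_convergence (fun _ => C) hf ?_ ?_ ?_
  · exact integrableOn_const hμ.ne
  · exact fun k => (ae_restrict_iff' hs).2 (Filter.Eventually.of_forall (hC k))
  · exact (ae_restrict_iff' hs).2 (Filter.Eventually.of_forall hlim)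

theorem abs_bilinear_le (b : F →L[ℝ] F →L[ℝ] ℝ) {p q : F} {P Q : ℝ} (hp : ‖p‖ ≤ P)
    (hq : ‖q‖ ≤ Q) : |b p q| ≤ ‖b‖ * P * Q := by
  have hP : 0 ≤ P := (norm_nonneg p).trans hp
  refine (b.le_opNorm₂ p q).trans ?_
  gcongr

/-- The integral of `b(∂ₐu, ∂_c u) - b(∂_c u, ∂ₐu)` is a boundary integral. -/
theorem IsC2Domain.integral_antisymm [CompleteSpace F] (hΩ : IsC2Domain Ω)
    (hbd : Bornology.IsBounded Ω) (b : F →L[ℝ] F →L[ℝ] ℝ) {u : EuclideanSpace ℝ (Fin n) → F}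
    {u' : EuclideanSpace ℝ (Fin n) → EuclideanSpace ℝ (Fin n) →L[ℝ] F} (hu : IsC1ExtOn Ω u u')
    (a c : EuclideanSpace ℝ (Fin n)) :
    ∫ x in Ω, (b (u' x a) (u' x c) - b (u' x c) (u' x a)) =
      ∫ x in frontier Ω, (⟪outwardUnitNormal Ω x, a⟫_ℝ * b (u x) (u' x c) -
        ⟪outwardUnitNormal Ω x, c⟫_ℝ * b (u x) (u' x a)) ∂μHE[n - 1] := by
  -- With errors `1 / (k + 1) ≤ 1`, the approximations and their derivatives converge pointwise on
  -- the closure and have uniform bounds there, so dominated convergence applies to both integrals.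
  choose g hg hgu using fun k : ℕ =>
    hΩ.exists_contDiff_approx hbd hu (ε := 1 / ((k : ℝ) + 1)) (by positivity)
  have hε : ∀ k : ℕ, 1 / ((k : ℝ) + 1) ≤ 1 := fun k => by
    rw [div_le_one (by positivity)]
    have : (0 : ℝ) ≤ k := by positivity
    linarith
  have hlim0 : ∀ x ∈ closure Ω, Filter.Tendsto (fun k => g k x) Filter.atTop (𝓝 (u x)) := by
    intro x hx
    refine tendsto_iff_dist_tendsto_zero.2 (squeeze_zero (fun _ => dist_nonneg)
      (fun k => (hgu k x hx).1) tendsto_one_div_add_atTop_nhds_zero_nat)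
  have hlim1 : ∀ x ∈ closure Ω, ∀ v, Filter.Tendsto (fun k => fderiv ℝ (g k) x v) Filter.atTop
      (𝓝 (u' x v)) := by
    intro x hx v
    have : Filter.Tendsto (fun k => fderiv ℝ (g k) x) Filter.atTop (𝓝 (u' x)) :=
      tendsto_iff_dist_tendsto_zero.2 (squeeze_zero (fun _ => dist_nonneg)
        (fun k => (hgu k x hx).2) tendsto_one_div_add_atTop_nhds_zero_nat)
    exact ((ContinuousLinearMap.apply ℝ F v).continuous.tendsto _).comp this
  obtain ⟨M, hM⟩ := hbd.isCompact_closure.exists_bound_of_continuousOn hu.continuousOn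
  obtain ⟨M', hM'⟩ := hbd.isCompact_closure.exists_bound_of_continuousOn hu.continuousOn'
  have hb0 : ∀ k, ∀ x ∈ closure Ω, ‖g k x‖ ≤ M + 1 := by
    intro k x hx
    have h1 := norm_le_norm_add_norm_sub' (g k x) (u x)
    rw [← dist_eq_norm] at h1
    linarith [hM x hx, (hgu k x hx).1, hε k]
  have hb1 : ∀ k, ∀ x ∈ closure Ω, ∀ v, ‖fderiv ℝ (g k) x v‖ ≤ (M' + 1) * ‖v‖ := by
    intro k x hx v
    refine ContinuousLinearMap.le_of_opNorm_le _ ?_ v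
    have h1 := norm_le_norm_add_norm_sub' (fderiv ℝ (g k) x) (u' x)
    rw [← dist_eq_norm] at h1
    linarith [hM' x hx, (hgu k x hx).2, hε k]
  have hcont : ∀ k v, Continuous fun x => fderiv ℝ (g k) x v := fun k v =>
    ((hg k).continuous_fderiv (by norm_num)).clm_apply continuous_const
  have hcb : ∀ {p q : EuclideanSpace ℝ (Fin n) → F}, Continuous p → Continuous q →
      Continuous fun x => b (p x) (q x) := fun hp hq =>
    (b.continuous.comp hp).clm_apply hq
  have hlb : ∀ {p q : ℕ → F} {p' q' : F}, Filter.Tendsto p Filter.atTop (𝓝 p') →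
      Filter.Tendsto q Filter.atTop (𝓝 q') →
      Filter.Tendsto (fun k => b (p k) (q k)) Filter.atTop (𝓝 (b p' q')) := fun {_ _ p' q'} hp hq =>
    ((b.continuous₂.tendsto (p', q')).comp (hp.prodMk_nhds hq))
  have hν : ∀ x ∈ frontier Ω, ∀ v, |⟪outwardUnitNormal Ω x, v⟫_ℝ| ≤ ‖v‖ := by
    intro x hx v
    have := abs_real_inner_le_norm (outwardUnitNormal Ω x) v
    rwa [(hΩ.isOutwardUnitNormal hx).1, one_mul] at this
  have hνc : ∀ v, ContinuousOn (fun x => ⟪outwardUnitNormal Ω x, v⟫_ℝ) (frontier Ω) := fun v =>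
    hΩ.continuousOn_outwardUnitNormal.inner (𝕜 := ℝ) continuousOn_const
  have hL := tendsto_setIntegral_of_bounded (μ := volume) (s := Ω)
    (f := fun k x => b (fderiv ℝ (g k) x a) (fderiv ℝ (g k) x c) -
      b (fderiv ℝ (g k) x c) (fderiv ℝ (g k) x a))
    (g := fun x => b (u' x a) (u' x c) - b (u' x c) (u' x a))
    hΩ.isOpen.measurableSet hbd.measure_lt_top
    (‖b‖ * ((M' + 1) * ‖a‖) * ((M' + 1) * ‖c‖) + ‖b‖ * ((M' + 1) * ‖c‖) * ((M' + 1) * ‖a‖))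
    (fun k => ((hcb (hcont k a) (hcont k c)).sub
      (hcb (hcont k c) (hcont k a))).aestronglyMeasurable)
    (fun k x hx => (abs_sub _ _).trans (add_le_add
      (abs_bilinear_le b (hb1 k x (subset_closure hx) a) (hb1 k x (subset_closure hx) c))
      (abs_bilinear_le b (hb1 k x (subset_closure hx) c) (hb1 k x (subset_closure hx) a))))
    (fun x hx => (hlb (hlim1 x (subset_closure hx) a) (hlim1 x (subset_closure hx) c)).sub
      (hlb (hlim1 x (subset_closure hx) c) (hlim1 x (subset_closure hx) a)))
  have hR := tendsto_setIntegral_of_bounded (μ := μHE[n - 1]) (s := frontier Ω)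
    (f := fun k x => ⟪outwardUnitNormal Ω x, a⟫_ℝ * b (g k x) (fderiv ℝ (g k) x c) -
      ⟪outwardUnitNormal Ω x, c⟫_ℝ * b (g k x) (fderiv ℝ (g k) x a))
    (g := fun x => ⟪outwardUnitNormal Ω x, a⟫_ℝ * b (u x) (u' x c) -
        ⟪outwardUnitNormal Ω x, c⟫_ℝ * b (u x) (u' x a))
    isClosed_frontier.measurableSet (hΩ.measure_frontier_lt_top hbd)
    (‖a‖ * (‖b‖ * (M + 1) * ((M' + 1) * ‖c‖)) + ‖c‖ * (‖b‖ * (M + 1) * ((M' + 1) * ‖a‖)))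
    (fun k => (((hνc a).mul (hcb (hg k).continuous (hcont k c)).continuousOn).sub
      ((hνc c).mul (hcb (hg k).continuous (hcont k a)).continuousOn)).aestronglyMeasurable
        isClosed_frontier.measurableSet)
    (fun k x hx => by
      have hx' := frontier_subset_closure hx
      refine (abs_sub _ _).trans (add_le_add ?_ ?_)
      · rw [abs_mul]
        exact mul_le_mul (hν x hx a) (abs_bilinear_le b (hb0 k x hx') (hb1 k x hx' c))
          (abs_nonneg _) (norm_nonneg _)
      · rw [abs_mul]
        exact mul_le_mul (hν x hx c) (abs_bilinear_le b (hb0 k x hx') (hb1 k x hx' a))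
          (abs_nonneg _) (norm_nonneg _))
    (fun x hx => by
      have hx' := frontier_subset_closure hx
      exact ((hlb (hlim0 x hx') (hlim1 x hx' c)).const_mul _).sub
        ((hlb (hlim0 x hx') (hlim1 x hx' a)).const_mul _))
  refine tendsto_nhds_unique hL ?_
  simp only [fun k => hΩ.integral_antisymm_of_contDiff hbd b (hg k) a c]
  exact hR

end NullLagrangian

/-! ### Chain rule along boundary curves -/

section Tangential

/-- Chain rule on the boundary, for curves which can be pushed into the domain. -/
theorem IsC1ExtOn.hasDerivAt_comp_curve {W F : Type*} [NormedAddCommGroup W] [NormedSpace ℝ W]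
    [NormedAddCommGroup F] [NormedSpace ℝ F] {S : Set W} {u : W → F} {u' : W → W →L[ℝ] F}
    (hu : IsC1ExtOn S u u') {c k : ℝ → W} (hcd : ∀ t, HasDerivAt c (k t) t) (hkc : Continuous k)
    {e : W} {R₀ : ℝ} (hR₀ : 0 < R₀)
    (hS : ∀ t s : ℝ, |t| < R₀ → 0 < s → s < R₀ → c t + s • e ∈ S) :
    HasDerivAt (fun t => u (c t)) (u' (c 0) (k 0)) 0 := by
  set x := c 0 with hx
  have hcc : Continuous c := continuous_iff_continuousAt.2 fun t => (hcd t).continuousAt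
  have hpush : ∀ t : ℝ, Filter.Tendsto (fun s : ℝ => c t + s • e) (𝓝[>] 0) (𝓝 (c t)) := by
    intro t
    have : ContinuousAt (fun s : ℝ => c t + s • e) 0 := by fun_prop
    have h := this.tendsto
    simp only [zero_smul, add_zero] at h
    exact h.mono_left nhdsWithin_le_nhds
  have hpushS : ∀ t : ℝ, |t| < R₀ → ∀ᶠ s in 𝓝[>] (0 : ℝ), c t + s • e ∈ S := by
    intro t ht
    filter_upwards [Ioo_mem_nhdsGT hR₀] with s hs using hS t s ht hs.1 hs.2
  have hct : ∀ t : ℝ, |t| < R₀ → c t ∈ closure S := fun t ht =>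
    mem_closure_of_tendsto (hpush t) (hpushS t ht)
  -- After subtracting the linear map `u' x`, the derivative along the pushed curves is `(u' - u'
  -- x)(k t)`, which is small near `x` by continuity of `u'` up to the boundary.
  have key : HasDerivAt (fun t => u (c t) - u' x (c t)) 0 0 := by
    rw [hasDerivAt_iff_isLittleO, Asymptotics.isLittleO_iff]
    intro ε hε
    set η := ε / (‖k 0‖ + 1) with hη
    have hη0 : 0 < η := by positivity
    obtain ⟨ρ₁, hρ₁, hu'⟩ := Metric.continuousWithinAt_iff.1
      (hu.continuousOn' x (hct 0 (by simpa using hR₀))) η hη0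
    have hcs : Continuous fun p : ℝ × ℝ => c p.1 + p.2 • e := by fun_prop
    have hev : ∀ᶠ p : ℝ × ℝ in 𝓝 (0, 0), c p.1 + p.2 • e ∈ Metric.ball x ρ₁ := by
      refine hcs.continuousAt.eventually ?_
      simp only [zero_smul, add_zero]
      exact Metric.ball_mem_nhds x hρ₁
    obtain ⟨ρ, hρ, hball⟩ := Metric.eventually_nhds_iff.1 hev
    have hkev : ∀ᶠ t in 𝓝 (0 : ℝ), ‖k t‖ < ‖k 0‖ + 1 :=
      hkc.norm.continuousAt.eventually_lt_const (lt_add_one ‖k 0‖)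
    obtain ⟨ρ', hρ', hkρ⟩ := Metric.eventually_nhds_iff.1 hkev
    set R := min (min ρ ρ') R₀ with hR
    have hR0 : 0 < R := lt_min (lt_min hρ hρ') hR₀
    have hRρ : R ≤ ρ := (min_le_left _ _).trans (min_le_left _ _)
    have hRρ' : R ≤ ρ' := (min_le_left _ _).trans (min_le_right _ _)
    have hRR : R ≤ R₀ := min_le_right _ _
    -- For `s > 0` the pushed curve lies in `S`, where `u` is differentiable and the mean value
    -- inequality applies. The bound does not depend on `s`, so it survives the limit `s → 0`.
    have hmv : ∀ s : ℝ, 0 < s → s < R → ∀ t : ℝ, |t| < R →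
        ‖(u (c t + s • e) - u' x (c t + s • e)) - (u (c 0 + s • e) - u' x (c 0 + s • e))‖ ≤
          ε * ‖t - 0‖ := by
      intro s hs0 hs t ht
      refine (convex_ball (0 : ℝ) R).norm_image_sub_le_of_norm_hasDerivWithin_le
        (f := fun t => u (c t + s • e) - u' x (c t + s • e))
        (f' := fun t => u' (c t + s • e) (k t) - u' x (k t)) (fun t' ht' => ?_)
        (fun t' ht' => ?_) (Metric.mem_ball_self hR0) (by simpa using ht)
      · have ht'' : |t'| < R := by simpa using ht'
        have h1 : HasDerivAt (fun t => c t + s • e) (k t') t' := (hcd t').add_const _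
        exact (((hu.hasFDerivAt _ (hS t' s (ht''.trans_le hRR) hs0
          (hs.trans_le hRR))).comp_hasDerivAt t' h1).sub
          ((u' x).hasFDerivAt.comp_hasDerivAt t' h1)).hasDerivWithinAt
      · have ht'' : |t'| < R := by simpa using ht'
        have hd : dist (c t' + s • e) x < ρ₁ := by
          refine hball (y := (t', s)) ?_
          rw [Prod.dist_eq, max_lt_iff]
          simp only [dist_zero_right, Real.norm_eq_abs, abs_of_pos hs0]
          exact ⟨ht''.trans_le hRρ, hs.trans_le hRρ⟩
        have h1 : ‖u' (c t' + s • e) - u' x‖ ≤ η := by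
          rw [← dist_eq_norm]
          exact (hu' (subset_closure (hS t' s (ht''.trans_le hRR) hs0 (hs.trans_le hRR))) hd).le
        have h2 : ‖k t'‖ ≤ ‖k 0‖ + 1 := (hkρ (by simpa using ht''.trans_le hRρ')).le
        rw [← sub_apply]
        calc _ ≤ ‖u' (c t' + s • e) - u' x‖ * ‖k t'‖ := ContinuousLinearMap.le_opNorm _ _
          _ ≤ η * (‖k 0‖ + 1) := by gcongr
          _ = ε := by rw [hη]; field_simp
    have hlim : ∀ t : ℝ, |t| < R → Filter.Tendsto
        (fun s : ℝ => u (c t + s • e) - u' x (c t + s • e)) (𝓝[>] 0)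
        (𝓝 (u (c t) - u' x (c t))) := by
      intro t ht
      have h2 : Filter.Tendsto (fun s : ℝ => c t + s • e) (𝓝[>] 0) (𝓝[closure S] (c t)) :=
        tendsto_nhdsWithin_iff.2
          ⟨hpush t, (hpushS t (ht.trans_le hRR)).mono fun s hs => subset_closure hs⟩
      exact ((hu.continuousOn _ (hct t (ht.trans_le hRR))).tendsto.comp h2).sub
        (((u' x).continuous.tendsto _).comp (hpush t))
    filter_upwards [Metric.ball_mem_nhds (0 : ℝ) hR0] with t ht
    have ht' : |t| < R := by simpa using ht
    rw [smul_zero, sub_zero]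
    refine le_of_tendsto ((hlim t ht').sub (hlim 0 (by simpa using hR0))).norm ?_
    filter_upwards [Ioo_mem_nhdsGT hR0] with s hs
    exact hmv s hs.1 hs.2 t ht'
  have h1 : HasDerivAt (fun t => u' x (c t)) (u' x (k 0)) 0 :=
    (u' x).hasFDerivAt.comp_hasDerivAt 0 (hcd 0)
  have h2 := key.add h1
  rw [zero_add] at h2
  exact h2.congr_of_eventuallyEq (Filter.Eventually.of_forall fun t => by simp)

variable {n : ℕ} {Ω : Set (EuclideanSpace ℝ (Fin n))} {F : Type*} [NormedAddCommGroup F]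
  [NormedSpace ℝ F]

/-- Each tangent vector of the boundary is the velocity of a boundary curve, along which functions
which are `C¹` up to the boundary obey the chain rule. -/
theorem IsC2Domain.exists_curve (hΩ : IsC2Domain Ω) {u : EuclideanSpace ℝ (Fin n) → F}
    {u' : EuclideanSpace ℝ (Fin n) → EuclideanSpace ℝ (Fin n) →L[ℝ] F} (hu : IsC1ExtOn Ω u u')
    {x : EuclideanSpace ℝ (Fin n)} (hx : x ∈ frontier Ω) {τ : EuclideanSpace ℝ (Fin n)}
    (hτ : ⟪outwardUnitNormal Ω x, τ⟫_ℝ = 0) :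
    ∃ c : ℝ → EuclideanSpace ℝ (Fin n), c 0 = x ∧ HasDerivAt c τ 0 ∧
      (∀ᶠ t in 𝓝 0, c t ∈ frontier Ω) ∧ HasDerivAt (fun t => u (c t)) (u' x τ) 0 := by
  obtain ⟨r, hr, e, he, γ, hγ, hchart⟩ := hΩ.exists_epigraph hx
  have hγ1 := hγ.of_le (show (1 : WithTop ℕ∞) ≤ 2 by norm_num)
  have hxb := Metric.mem_ball_self (x := x) hr
  have hfr := frontier_inter_ball_eq he hγ1 hchart
  obtain ⟨y₀, hy₀⟩ : x ∈ Set.range (graphMap γ) := by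
    have : x ∈ Metric.ball x r ∩ frontier Ω := ⟨hxb, hx⟩
    rw [hfr] at this
    exact this.2
  have hPx : (perp e).orthogonalProjectionOnto x = y₀ := by
    rw [← hy₀, graphMap, orthogonalProjectionOnto_add_smul]
  set v := (perp e).orthogonalProjectionOnto τ with hv
  set k : ℝ → EuclideanSpace ℝ (Fin n) := fun t => (v : EuclideanSpace ℝ (Fin n)) +
    fderiv ℝ γ (y₀ + t • v) v • e with hk
  set c : ℝ → EuclideanSpace ℝ (Fin n) := fun t => graphMap γ (y₀ + t • v) with hc
  have hcd : ∀ t, HasDerivAt c (k t) t := by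
    intro t
    have h1 : HasDerivAt (fun t : ℝ => y₀ + t • v) v t := by
      simpa using ((hasDerivAt_id t).smul_const v).const_add y₀
    exact (hasFDerivAt_graphMap hγ1 (y₀ + t • v)).comp_hasDerivAt t h1
  have hc0 : c 0 = x := by simp [hc, hy₀]
  -- Orthogonality to the normal says `dγ(v) = ⟪e, τ⟫`, so lifting the projection `v` of `τ` to the
  -- graph recovers `τ`.
  have hk0 : k 0 = τ := by
    rw [outwardUnitNormal_eq_graphNormal he hγ1 hchart ⟨hxb, hx⟩] at hτ
    have h1 := graphDensity_mul_inner_graphNormal γ ((perp e).orthogonalProjectionOnto x) τ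
    rw [hτ, mul_zero, hPx] at h1
    have h2 : fderiv ℝ γ y₀ v = ⟪e, τ⟫_ℝ := by linarith
    simp only [hk, zero_smul, add_zero, h2]
    exact orthogonalProjectionOnto_add_inner_smul he τ
  have hkc : Continuous k := by
    have h1 : Continuous fun t : ℝ => fderiv ℝ γ (y₀ + t • v) v :=
      ((hγ1.continuous_fderiv (by norm_num)).comp (by fun_prop)).clm_apply continuous_const
    exact continuous_const.add (h1.smul continuous_const)
  have hcc : Continuous c := continuous_iff_continuousAt.2 fun t => (hcd t).continuousAt
  have hmem : ∀ t s : ℝ, 0 < s → c t + s • e ∈ Metric.ball x r → c t + s • e ∈ Ω := by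
    intro t s hs hb
    have hcs : c t + s • e = ((y₀ + t • v : perp e) : EuclideanSpace ℝ (Fin n)) +
        (γ (y₀ + t • v) + s) • e := by
      simp only [hc, graphMap, add_smul, add_assoc]
    rw [hchart _ hb, hcs]
    change γ _ < _
    rw [orthogonalProjectionOnto_add_smul, inner_add_smul_self he]
    linarith
  have hfrc : ∀ t, c t ∈ Metric.ball x r → c t ∈ frontier Ω := by
    intro t ht
    have : c t ∈ Metric.ball x r ∩ Set.range (graphMap γ) := ⟨ht, y₀ + t • v, rfl⟩
    rw [← hfr] at this
    exact this.2
  have hball : ∀ᶠ t in 𝓝 0, c t ∈ Metric.ball x r :=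
    hcc.continuousAt.eventually (by rw [hc0]; exact Metric.ball_mem_nhds x hr)
  have hev : ∀ᶠ p : ℝ × ℝ in 𝓝 (0, 0), c p.1 + p.2 • e ∈ Metric.ball x r := by
    have hcs : Continuous fun p : ℝ × ℝ => c p.1 + p.2 • e := by fun_prop
    refine hcs.continuousAt.eventually ?_
    simp only [hc0, zero_smul, add_zero]
    exact Metric.ball_mem_nhds x hr
  obtain ⟨ρ, hρ, hρb⟩ := Metric.eventually_nhds_iff.1 hev
  refine ⟨c, hc0, hk0 ▸ hcd 0, hball.mono hfrc, ?_⟩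
  have := hu.hasDerivAt_comp_curve hcd hkc (e := e) hρ fun t s ht hs hsρ => by
    refine hmem t s hs (hρb (y := (t, s)) ?_)
    rw [Prod.dist_eq, max_lt_iff]
    simp only [dist_zero_right, Real.norm_eq_abs, abs_of_pos hs]
    exact ⟨ht, hsρ⟩
  rwa [hc0, hk0] at this

end Tangential

/-! ### Real bilinear forms -/

section RealForms

variable {𝕜 : Type*} [RCLike 𝕜] {E F : Type*}
  [NormedAddCommGroup E] [InnerProductSpace 𝕜 E] [NormedAddCommGroup F] [InnerProductSpace 𝕜 F]
  [NormedSpace ℝ F] [IsScalarTower ℝ 𝕜 F]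

/-- The real bilinear form `(f, g) ↦ Re ⟨S f, T g⟩`. -/
noncomputable def reForm (S T : F →L[𝕜] E) : F →L[ℝ] F →L[ℝ] ℝ :=
  LinearMap.mkContinuous₂
    (LinearMap.mk₂ ℝ (fun f g => RCLike.re (inner 𝕜 (S f) (T g)))
      (fun f f' g => by rw [map_add, inner_add_left, map_add])
      (fun c f g => by
        rw [RCLike.real_smul_eq_coe_smul (K := 𝕜), map_smul, inner_smul_left, RCLike.conj_ofReal,
          RCLike.re_ofReal_mul, smul_eq_mul])
      (fun f g g' => by rw [map_add, inner_add_right, map_add])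
      (fun c f g => by
        rw [RCLike.real_smul_eq_coe_smul (K := 𝕜), map_smul, inner_smul_right,
          RCLike.re_ofReal_mul, smul_eq_mul]))
    (‖S‖ * ‖T‖) (fun f g => by
      rw [LinearMap.mk₂_apply, Real.norm_eq_abs]
      calc _ ≤ ‖inner 𝕜 (S f) (T g)‖ := RCLike.abs_re_le_norm _
        _ ≤ ‖S f‖ * ‖T g‖ := norm_inner_le_norm _ _
        _ ≤ (‖S‖ * ‖f‖) * (‖T‖ * ‖g‖) := by
          gcongr
          · exact S.le_opNorm f
          · exact T.le_opNorm g
        _ = _ := by ring)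

theorem reForm_apply (S T : F →L[𝕜] E) (f g : F) :
    reForm S T f g = RCLike.re (inner 𝕜 (S f) (T g)) := rfl

theorem reForm_comm (S T : F →L[𝕜] E) (f g : F) : reForm S T f g = reForm T S g f := by
  rw [reForm_apply, reForm_apply, inner_re_symm]

end RealForms

/-! ### Expansion of the integrands in coordinates -/

section Algebra

variable {𝕜 : Type*} [RCLike 𝕜] {n : ℕ} {E F G : Type*}
  [NormedAddCommGroup E] [InnerProductSpace 𝕜 E]
  [NormedAddCommGroup F] [InnerProductSpace 𝕜 F]
  [NormedAddCommGroup G] [InnerProductSpace 𝕜 G]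

theorem opSymbol_single (B : Fin n → F →L[𝕜] E) (i : Fin n) :
    opSymbol B (EuclideanSpace.single i 1) = B i := by
  rw [opSymbol, Finset.sum_eq_single i]
  · simp
  · intro j _ hj
    simp [hj]
  · simp

variable [NormedSpace ℝ F] [IsScalarTower ℝ 𝕜 F]

theorem norm_sum_apply_sq (A : Fin n → F →L[𝕜] G) (X : Fin n → F) :
    ‖∑ j, A j (X j)‖ ^ 2 = ∑ i, ∑ j, reForm (A i) (A j) (X i) (X j) := by
  rw [← inner_self_eq_norm_sq (𝕜 := 𝕜), sum_inner, map_sum]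
  refine Finset.sum_congr rfl fun i _ => ?_
  rw [inner_sum, map_sum]
  rfl

theorem re_inner_opSymbol (B : Fin n → F →L[𝕜] E) (S : F →L[𝕜] E)
    (ξ : EuclideanSpace ℝ (Fin n)) (f g : F) :
    RCLike.re (inner 𝕜 (S f) (opSymbol B ξ g)) = ∑ j, ξ j * reForm S (B j) f g := by
  rw [opSymbol, sum_apply, inner_sum, map_sum]
  refine Finset.sum_congr rfl fun j _ => ?_
  rw [smul_apply, inner_smul_right, RCLike.re_ofReal_mul]
  rfl

variable [CompleteSpace E] [CompleteSpace F] [CompleteSpace G]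

/-- Because `Mᵢⱼ` contains `Bⱼ* Bᵢ` rather than `Bᵢ* Bⱼ`, the `B` part appears with its two
derivatives interchanged compared with `‖ℬu‖²`, while the `A` part matches `‖𝒜u‖²`. The discrepancy
is the null Lagrangian. -/
theorem traceInner_laplaceMap (A : Fin n → F →L[𝕜] G) (B : Fin n → F →L[𝕜] E)
    (X : EuclideanSpace ℝ (Fin n) →L[ℝ] F) :
    traceInner 𝕜 X (laplaceMap A B X) = ∑ i, ∑ j,
      (reForm (A i) (A j) (X (EuclideanSpace.single i 1)) (X (EuclideanSpace.single j 1)) +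
        reForm (B i) (B j) (X (EuclideanSpace.single j 1)) (X (EuclideanSpace.single i 1))) := by
  have h : ∀ i, laplaceMap A B X (EuclideanSpace.single i 1) =
      ∑ j, laplaceCoeff A B i j (X (EuclideanSpace.single j 1)) := by
    intro i
    rw [laplaceMap, sum_apply, Finset.sum_eq_single i]
    · simp [sum_apply]
    · intro k _ hk
      simp [sum_apply, hk]
    · simp
  rw [traceInner]
  refine Finset.sum_congr rfl fun i _ => ?_
  rw [h, inner_sum, map_sum]
  refine Finset.sum_congr rfl fun j _ => ?_
  rw [laplaceCoeff, add_apply, inner_add_right, map_add, ContinuousLinearMap.comp_apply,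
    ContinuousLinearMap.comp_apply, ContinuousLinearMap.adjoint_inner_right,
    ContinuousLinearMap.adjoint_inner_right, reForm_comm (B i)]
  rfl

theorem re_inner_leviMatrix (B : Fin n → F →L[𝕜] E)
    (N : EuclideanSpace ℝ (Fin n) → EuclideanSpace ℝ (Fin n)) (x : EuclideanSpace ℝ (Fin n))
    (f : F) : RCLike.re (inner 𝕜 f (leviMatrix B N x f)) =
      ∑ i, ∑ j, fderiv ℝ N x (EuclideanSpace.single i 1) j * reForm (B i) (B j) f f := by
  rw [leviMatrix, sum_apply, inner_sum, map_sum]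
  refine Finset.sum_congr rfl fun i _ => ?_
  rw [ContinuousLinearMap.comp_apply, ContinuousLinearMap.adjoint_inner_right, opSymbol_single,
    re_inner_opSymbol]

end Algebra

/-! ### The boundary integrand and the Levi form -/

section Boundary

variable {𝕜 : Type*} [RCLike 𝕜] {n : ℕ} {E F : Type*}
  [NormedAddCommGroup E] [InnerProductSpace 𝕜 E]
  [NormedAddCommGroup F] [InnerProductSpace 𝕜 F] [NormedSpace ℝ F] [IsScalarTower ℝ 𝕜 F]
  {Ω : Set (EuclideanSpace ℝ (Fin n))}

/-- If `𝔹(N) u = 0` on the boundary, then `𝔹(∂_τ N) u + 𝔹(ν) ∂_τ u = 0` for tangent vectors. -/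
theorem IsC2Domain.tangential_derivative_eq_zero (hΩ : IsC2Domain Ω) (B : Fin n → F →L[𝕜] E)
    {N : EuclideanSpace ℝ (Fin n) → EuclideanSpace ℝ (Fin n)} {x : EuclideanSpace ℝ (Fin n)}
    (hN : DifferentiableAt ℝ N x) (hNν : ∀ x ∈ frontier Ω, N x = outwardUnitNormal Ω x)
    {u : EuclideanSpace ℝ (Fin n) → F}
    {u' : EuclideanSpace ℝ (Fin n) → EuclideanSpace ℝ (Fin n) →L[ℝ] F} (hu : IsC1ExtOn Ω u u')
    (hBu : ∀ x ∈ frontier Ω, opSymbol B (outwardUnitNormal Ω x) (u x) = 0)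
    (hx : x ∈ frontier Ω) {τ : EuclideanSpace ℝ (Fin n)}
    (hτ : ⟪outwardUnitNormal Ω x, τ⟫_ℝ = 0) (S : F →L[𝕜] E) (f : F) :
    ∑ j, (fderiv ℝ N x τ j * reForm S (B j) f (u x) +
      outwardUnitNormal Ω x j * reForm S (B j) f (u' x τ)) = 0 := by
  obtain ⟨c, hc0, hcd, hcf, hcu⟩ := hΩ.exists_curve hu hx hτ
  -- Both `N = ν` and `𝔹(ν)u = 0` are available only on `∂Ω`, so the curve has to stay there. The
  -- relation is paired with `S f` to obtain a scalar function of `t`.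
  have hzero : (fun t => ∑ j, N (c t) j * reForm S (B j) f (u (c t))) =ᶠ[𝓝 0] fun _ => 0 := by
    filter_upwards [hcf] with t ht
    rw [← re_inner_opSymbol, hNν _ ht, hBu _ ht, inner_zero_right, map_zero]
  have hNc : HasDerivAt (fun t => N (c t)) (fderiv ℝ N x τ) 0 := by
    have h1 : HasFDerivAt N (fderiv ℝ N x) (c 0) := by rw [hc0]; exact hN.hasFDerivAt
    exact h1.comp_hasDerivAt 0 hcd
  have hder : HasDerivAt (fun t => ∑ j, N (c t) j * reForm S (B j) f (u (c t)))
      (∑ j, (fderiv ℝ N x τ j * reForm S (B j) f (u (c 0)) +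
        N (c 0) j * reForm S (B j) f (u' x τ))) 0 := by
    refine HasDerivAt.fun_sum fun j _ => ?_
    have h1 : HasDerivAt (fun t => N (c t) j) (fderiv ℝ N x τ j) 0 :=
      (EuclideanSpace.proj j : EuclideanSpace ℝ (Fin n) →L[ℝ] ℝ).hasFDerivAt.comp_hasDerivAt 0 hNc
    exact h1.mul ((reForm S (B j) f).hasFDerivAt.comp_hasDerivAt 0 hcu)
  have h := hder.unique ((hasDerivAt_const (0 : ℝ) (0 : ℝ)).congr_of_eventuallyEq hzero)
  rwa [hc0, hNν x hx] at h

theorem real_inner_single_right (v : EuclideanSpace ℝ (Fin n)) (i : Fin n) :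
    ⟪v, EuclideanSpace.single i 1⟫_ℝ = v i := by
  simp [EuclideanSpace.inner_single_right]

/-- Under the boundary condition, the boundary integrand is given by the Levi matrix. -/
theorem IsC2Domain.sum_boundary_eq (hΩ : IsC2Domain Ω) (B : Fin n → F →L[𝕜] E)
    {N : EuclideanSpace ℝ (Fin n) → EuclideanSpace ℝ (Fin n)} {x : EuclideanSpace ℝ (Fin n)}
    (hN : DifferentiableAt ℝ N x) (hNν : ∀ x ∈ frontier Ω, N x = outwardUnitNormal Ω x)
    {u : EuclideanSpace ℝ (Fin n) → F}
    {u' : EuclideanSpace ℝ (Fin n) → EuclideanSpace ℝ (Fin n) →L[ℝ] F} (hu : IsC1ExtOn Ω u u')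
    (hBu : ∀ x ∈ frontier Ω, opSymbol B (outwardUnitNormal Ω x) (u x) = 0)
    (hx : x ∈ frontier Ω) :
    ∑ i, ∑ j, (outwardUnitNormal Ω x i *
        reForm (B i) (B j) (u x) (u' x (EuclideanSpace.single j 1)) -
      outwardUnitNormal Ω x j *
        reForm (B i) (B j) (u x) (u' x (EuclideanSpace.single i 1))) =
      ∑ i, ∑ j, fderiv ℝ N x (EuclideanSpace.single i 1) j * reForm (B i) (B j) (u x) (u x) := by
  set ν := outwardUnitNormal Ω x with hν
  have hνn : ‖ν‖ = 1 := (hΩ.isOutwardUnitNormal hx).1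
  have hnormal : ∀ j g, ∑ i, ν i * reForm (B i) (B j) (u x) g = 0 := by
    intro j g
    simp_rw [reForm_comm (B _) (B j)]
    rw [← re_inner_opSymbol, hBu x hx, inner_zero_right, map_zero]
  -- `R i τ` is `𝔹(∂_τ N)u + 𝔹(ν)∂_τ u` paired with `Bᵢ u`. It is linear in `τ` and vanishes for
  -- tangential `τ`, so only the normal part `νᵢ ν` of `eᵢ` contributes.
  set R : Fin n → EuclideanSpace ℝ (Fin n) → ℝ := fun i τ =>
    ∑ j, (fderiv ℝ N x τ j * reForm (B i) (B j) (u x) (u x) +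
      ν j * reForm (B i) (B j) (u x) (u' x τ)) with hR
  have hRν : ∀ i, R i (EuclideanSpace.single i 1) = ν i * R i ν := by
    intro i
    have h0 : R i (EuclideanSpace.single i 1 - ν i • ν) = 0 := by
      refine hΩ.tangential_derivative_eq_zero B hN hNν hu hBu hx ?_ (B i) (u x)
      rw [← hν, inner_sub_right, inner_smul_right, real_inner_self_eq_norm_sq, hνn,
        real_inner_single_right]
      ring
    have hlin : R i (EuclideanSpace.single i 1 - ν i • ν) =
        R i (EuclideanSpace.single i 1) - ν i * R i ν := by
      simp only [hR]
      rw [Finset.mul_sum, ← Finset.sum_sub_distrib]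
      refine Finset.sum_congr rfl fun j _ => ?_
      simp only [map_sub, map_smul, PiLp.sub_apply, PiLp.smul_apply, smul_eq_mul]
      ring
    linarith
  -- Summed over `i`, the normal contributions `νᵢ R i ν` contain `∑ νᵢ Bᵢ u = 𝔹(ν)u = 0`. So the
  -- values of `∂_ν N` and `∂_ν u` play no role, and the result does not depend on the extension
  -- `N`.
  have hsum : ∑ i, R i (EuclideanSpace.single i 1) = 0 := by
    simp_rw [hRν, hR, Finset.mul_sum]
    rw [Finset.sum_comm]
    refine Finset.sum_eq_zero fun j _ => ?_
    calc _ = fderiv ℝ N x ν j * ∑ i, ν i * reForm (B i) (B j) (u x) (u x) +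
          ν j * ∑ i, ν i * reForm (B i) (B j) (u x) (u' x ν) := by
          rw [Finset.mul_sum, Finset.mul_sum, ← Finset.sum_add_distrib]
          exact Finset.sum_congr rfl fun i _ => by ring
      _ = 0 := by rw [hnormal, hnormal, mul_zero, mul_zero, add_zero]
  have hfirst : ∑ i, ∑ j, ν i *
      reForm (B i) (B j) (u x) (u' x (EuclideanSpace.single j 1)) = 0 := by
    rw [Finset.sum_comm]
    exact Finset.sum_eq_zero fun j _ => hnormal j _
  simp only [hR, Finset.sum_add_distrib] at hsum
  simp only [Finset.sum_sub_distrib]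
  rw [hfirst]
  linarith

end Boundary

/-! ### The Weitzenböck identity -/

theorem mainTheorem1 {𝕜 : Type*} [RCLike 𝕜] {n : ℕ} {E F G : Type*}
    [NormedAddCommGroup E] [InnerProductSpace 𝕜 E] [CompleteSpace E]
    [NormedAddCommGroup F] [InnerProductSpace 𝕜 F] [CompleteSpace F]
    [NormedSpace ℝ F] [IsScalarTower ℝ 𝕜 F]
    [NormedAddCommGroup G] [InnerProductSpace 𝕜 G] [CompleteSpace G]
    (A : Fin n → F →L[𝕜] G) (B : Fin n → F →L[𝕜] E)
    (Ω : Set (EuclideanSpace ℝ (Fin n))) (hΩ : IsC2Domain Ω) (hbd : Bornology.IsBounded Ω)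
    -- `N` is any `C¹` extension of the outward unit normal to a neighbourhood `U` of `∂Ω`
    (N : EuclideanSpace ℝ (Fin n) → EuclideanSpace ℝ (Fin n))
    (U : Set (EuclideanSpace ℝ (Fin n))) (hU : IsOpen U) (hΩU : frontier Ω ⊆ U)
    (hN : ContDiffOn ℝ 1 N U) (hNν : ∀ x ∈ frontier Ω, N x = outwardUnitNormal Ω x)
    (u : EuclideanSpace ℝ (Fin n) → F) (hu : IsC1OnClosure Ω u)
    (hBu : ∀ x ∈ frontier Ω, opSymbol B (outwardUnitNormal Ω x) (u x) = 0) :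
    IntegrableOn (fun x => ‖diffOp A u x‖ ^ 2 + ‖diffOp B u x‖ ^ 2) Ω volume ∧
    IntegrableOn (fun x => traceInner 𝕜 (fderiv ℝ u x) (laplaceMap A B (fderiv ℝ u x)))
      Ω volume ∧
    IntegrableOn (fun x => RCLike.re (inner 𝕜 (u x) (leviMatrix B N x (u x))))
      (frontier Ω) μHE[n - 1] ∧
    (∫ x in Ω, (‖diffOp A u x‖ ^ 2 + ‖diffOp B u x‖ ^ 2)) -
        ∫ x in Ω, traceInner 𝕜 (fderiv ℝ u x) (laplaceMap A B (fderiv ℝ u x)) =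
      ∫ x in frontier Ω, RCLike.re (inner 𝕜 (u x) (leviMatrix B N x (u x))) ∂μHE[n - 1] := by
  obtain ⟨hc, u', hc', hd⟩ := hu
  have hu : IsC1ExtOn Ω u u' := ⟨hc, hc', hd⟩
  set e : Fin n → EuclideanSpace ℝ (Fin n) := fun i => EuclideanSpace.single i 1 with he
  have hcont : ∀ (b : F →L[ℝ] F →L[ℝ] ℝ) (v w : EuclideanSpace ℝ (Fin n)),
      ContinuousOn (fun x => b (u' x v) (u' x w)) (closure Ω) := fun b v w =>
    (b.continuous.comp_continuousOn (hc'.clm_apply continuousOn_const)).clm_apply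
      (hc'.clm_apply continuousOn_const)
  have hcontν : ∀ (b : F →L[ℝ] F →L[ℝ] ℝ) (v w : EuclideanSpace ℝ (Fin n)),
      ContinuousOn (fun x => ⟪outwardUnitNormal Ω x, v⟫_ℝ * b (u x) (u' x w)) (frontier Ω) :=
    fun b v w => (hΩ.continuousOn_outwardUnitNormal.inner (𝕜 := ℝ) continuousOn_const).mul
      (((b.continuous.comp_continuousOn hc).clm_apply
        (hc'.clm_apply continuousOn_const)).mono frontier_subset_closure)
  have hΩm : MeasurableSet Ω := hΩ.isOpen.measurableSet
  -- On `Ω` the integrands are rewritten with `u'`, which, unlike `fderiv ℝ u`, is known to be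
  -- continuous on the compact closure. This yields absolute convergence.
  have h1 : Set.EqOn (fun x => ∑ i, ∑ j, (reForm (A i) (A j) (u' x (e i)) (u' x (e j)) +
      reForm (B i) (B j) (u' x (e i)) (u' x (e j))))
      (fun x => ‖diffOp A u x‖ ^ 2 + ‖diffOp B u x‖ ^ 2) Ω := fun x hx => by
    simp only [diffOp, (hd x hx).fderiv, norm_sum_apply_sq, Finset.sum_add_distrib, he]
  have h2 : Set.EqOn (fun x => ∑ i, ∑ j, (reForm (A i) (A j) (u' x (e i)) (u' x (e j)) +
      reForm (B i) (B j) (u' x (e j)) (u' x (e i))))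
      (fun x => traceInner 𝕜 (fderiv ℝ u x) (laplaceMap A B (fderiv ℝ u x))) Ω :=
    fun x hx => by simp only [(hd x hx).fderiv, traceInner_laplaceMap, he]
  have hI1 := (integrableOn_of_continuousOn_closure hbd (continuousOn_finsetSum _ fun i _ =>
    continuousOn_finsetSum _ fun j _ => (hcont (reForm (A i) (A j)) (e i) (e j)).add
      (hcont (reForm (B i) (B j)) (e i) (e j)))).congr_fun h1 hΩm
  have hI2 := (integrableOn_of_continuousOn_closure hbd (continuousOn_finsetSum _ fun i _ =>
    continuousOn_finsetSum _ fun j _ => (hcont (reForm (A i) (A j)) (e i) (e j)).add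
      (hcont (reForm (B i) (B j)) (e j) (e i)))).congr_fun h2 hΩm
  have hN' : ContinuousOn (fderiv ℝ N) (frontier Ω) :=
    (hN.continuousOn_fderiv_of_isOpen hU le_rfl).mono hΩU
  have hNd : ∀ x ∈ frontier Ω, DifferentiableAt ℝ N x := fun x hx =>
    (hN.contDiffAt (hU.mem_nhds (hΩU hx))).differentiableAt one_ne_zero
  have huf : ContinuousOn u (frontier Ω) := hc.mono frontier_subset_closure
  refine ⟨hI1, hI2, ?_, ?_⟩
  · simp only [re_inner_leviMatrix]
    refine hΩ.integrableOn_frontier hbd (continuousOn_finsetSum _ fun i _ =>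
      continuousOn_finsetSum _ fun j _ => ContinuousOn.mul ?_ ?_)
    · exact (EuclideanSpace.proj (𝕜 := ℝ) j).continuous.comp_continuousOn
        (hN'.clm_apply continuousOn_const)
    · exact ((reForm (B i) (B j)).continuous.comp_continuousOn huf).clm_apply huf
  · rw [← integral_sub hI1 hI2]
    -- The `A` terms cancel pointwise here.
    calc _ = ∫ x in Ω, ∑ i, ∑ j, (reForm (B i) (B j) (u' x (e i)) (u' x (e j)) -
            reForm (B i) (B j) (u' x (e j)) (u' x (e i))) := by
          refine setIntegral_congr_fun hΩm fun x hx => ?_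
          simp only [← h1 hx, ← h2 hx, ← Finset.sum_sub_distrib, add_sub_add_left_eq_sub]
      _ = ∑ i, ∑ j, ∫ x in Ω, (reForm (B i) (B j) (u' x (e i)) (u' x (e j)) -
            reForm (B i) (B j) (u' x (e j)) (u' x (e i))) := by
          refine (integral_finsetSum _ fun i _ => integrableOn_of_continuousOn_closure hbd
            (continuousOn_finsetSum _ fun j _ => (hcont _ _ _).sub (hcont _ _ _))).trans ?_
          exact Finset.sum_congr rfl fun i _ => integral_finsetSum _ fun j _ =>
            integrableOn_of_continuousOn_closure hbd ((hcont _ _ _).sub (hcont _ _ _))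
      _ = ∑ i, ∑ j, ∫ x in frontier Ω,
            (⟪outwardUnitNormal Ω x, e i⟫_ℝ * reForm (B i) (B j) (u x) (u' x (e j)) -
              ⟪outwardUnitNormal Ω x, e j⟫_ℝ * reForm (B i) (B j) (u x) (u' x (e i)))
              ∂μHE[n - 1] :=
          Finset.sum_congr rfl fun i _ => Finset.sum_congr rfl fun j _ =>
            hΩ.integral_antisymm hbd _ hu _ _
      _ = ∫ x in frontier Ω, ∑ i, ∑ j,
            (⟪outwardUnitNormal Ω x, e i⟫_ℝ * reForm (B i) (B j) (u x) (u' x (e j)) -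
              ⟪outwardUnitNormal Ω x, e j⟫_ℝ * reForm (B i) (B j) (u x) (u' x (e i)))
              ∂μHE[n - 1] := by
          refine Eq.symm ((integral_finsetSum _ fun i _ => hΩ.integrableOn_frontier hbd
            (continuousOn_finsetSum _ fun j _ => (hcontν _ _ _).sub (hcontν _ _ _))).trans ?_)
          exact Finset.sum_congr rfl fun i _ => integral_finsetSum _ fun j _ =>
            hΩ.integrableOn_frontier hbd ((hcontν _ _ _).sub (hcontν _ _ _))
      _ = _ := by
          refine setIntegral_congr_fun isClosed_frontier.measurableSet fun x hx => ?_
          simp only [he, real_inner_single_right, re_inner_leviMatrix]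
          exact hΩ.sum_boundary_eq B (hNd x hx) hNν hu hBu hx
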